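/- **Notation.** Let $h=\sum h_{\alpha\beta}X^\alpha Y^\beta\in\mathbf C[X,Y]$ be a non-zero polynomial, $\operatorname{supp}h=\{(\alpha,\beta):h_{\alpha\beta}\neq0\}$, and let $\Delta_h\subset\mathbf R^2$ be the convex hull of $\operatorname{supp}h$. The right Newton polygon $\mathcal N_h^{(r)}$ is the set of the one-dimensional faces $S$ of $\Delta_h$ that lie on its right side, i.e. such that no point of $\Delta_h$ lies strictly to the right of a point of $S$ at the same height; equivalently, the non-horizontal boundary segments forming the right-hand boundary of $\Delta_h$ from its lowest to its highest level. (If $\Delta_h$ is itself a non-horizontal segment, then $\mathcal N_h^{(r)}=\{\Delta_h\}$.) For $S\in\mathcal N_h^{(r)}$ let $|S_1|,|S_2|$ be the lengths of the projections of $S$ on the horizontal and the vertical axis, let $\sigma(S)=0$ if $S$ is parallel to an axis and otherwise let $\sigma(S)=\pm1$ be opposite to the sign of the slope of $S$. The declivity of $S$ is $\frac{|S_1|}{|S_2|}\sigma(S)$, and $\operatorname{in}(h,S)=\sum_{(\alpha,\beta)\in S}h_{\alpha\beta}X^\alpha Y^\beta$. Let $\mathbf C((\frac1X))^*=\bigcup_{k\ge1}\mathbf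 C((X^{-1/k}))$ be the field of formal Laurent–Puiseux series at infinity. For a non-zero $a(X)=a_0X^{\theta_0}+a_1X^{\theta_1}+\cdots$ with $\theta_0>\theta_1>\cdots$ and $a_0\ne0$ put $\deg a=\theta_0$ and $a^+(X)=a_0X^{\theta_0}$ (the leading term). A solution of $h(X,Y)=0$ is a series $a(X)\in\mathbf C((\frac1X))^*$ with $h(X,a(X))=0$; its multiplicity is the least $m\ge1$ with $\frac{\partial^m h}{\partial Y^m}(X,a(X))\neq0$. **Theorem 6.3.** Let $h\in\mathbf C[X,Y]$ be a non-zero polynomial. (a) If $a(X)$ is a non-zero solution of $h(X,Y)=0$ in $\mathbf C((\frac1X))^*$, then there is a segment $S\in\mathcal N_h^{(r)}$ such that $\deg a=\frac{|S_1|}{|S_2|}\sigma(S)$ and $\operatorname{in}(h,S)(X,a^+(X))=0$. (b) Let $S\in\mathcal N_h^{(r)}$ and $\theta=\frac{|S_1|}{|S_2|}\sigma(S)$. The set of non-zero solutions of $h(X,Y)=0$ in $\mathbf C((\frac1X))^*$ of degree $\theta$ is finite, and there are exactly $|S_2|$ of them, counted with multiplicities. Moreover, if $c$ is a non-zero complex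 number and $k\ge0$ is the largest integer such that $(Y-cX^\theta)^k$ divides $\operatorname{in}(h,S)$ in $\mathbf C((\frac1X))^*[Y]$, then there are exactly $k$ solutions, counted with multiplicities, with leading term $cX^\theta$. -/

import Mathlib

open scoped Polynomial.Bivariate

noncomputable section

/-! ### Laurent–Puiseux series at infinity

A formal series in descending rational powers of `X` is a Hahn series in `1/X`: the coefficient
of `X ^ θ` is the Hahn coefficient at the exponent `-θ`. -/

/-- The additive map `n ↦ n / (k + 1)` from `ℤ` to `ℚ`. -/
def divExponent (k : ℕ) : ℤ →+ ℚ where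
  toFun n := (n : ℚ) / ((k : ℚ) + 1)
  map_zero' := by simp
  map_add' m n := by push_cast; ring

lemma divExponent_le_iff (k : ℕ) (m n : ℤ) :
    divExponent k m ≤ divExponent k n ↔ m ≤ n := by
  have hk : (0 : ℚ) < (k : ℚ) + 1 := by positivity
  change (m : ℚ) / ((k : ℚ) + 1) ≤ (n : ℚ) / ((k : ℚ) + 1) ↔ m ≤ n
  rw [div_le_div_iff_of_pos_right hk]
  exact Int.cast_le

lemma divExponent_injective (k : ℕ) : Function.Injective (divExponent k) := fun m n hmn =>
  le_antisymm ((divExponent_le_iff k m n).1 hmn.le) ((divExponent_le_iff k n m).1 hmn.ge)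

/-- The field embedding `ℂ((T)) → ℂ((1/X))^*`, `T ↦ X ^ (-1 / (k + 1))`. Its range is the field
`ℂ((X ^ (-1 / (k + 1))))`. -/
def laurentEmb (k : ℕ) : LaurentSeries ℂ →+* HahnSeries ℚ ℂ :=
  HahnSeries.embDomainRingHom (divExponent k) (divExponent_injective k) (divExponent_le_iff k)

lemma laurentEmb_coeff (k : ℕ) (p : LaurentSeries ℂ) (n : ℤ) :
    (laurentEmb k p).coeff (divExponent k n) = p.coeff n :=
  HahnSeries.embDomain_coeff (f := ⟨⟨divExponent k, divExponent_injective k⟩,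
    divExponent_le_iff k _ _⟩)

lemma mem_range_laurentEmb_iff (k : ℕ) (a : HahnSeries ℚ ℂ) :
    a ∈ (laurentEmb k).fieldRange ↔ ∀ q ∈ a.support, ∃ n : ℤ, divExponent k n = q := by
  constructor
  · rintro ⟨p, rfl⟩ q hq
    obtain ⟨n, -, hn⟩ := HahnSeries.support_embDomain_subset hq
    exact ⟨n, hn⟩
  · intro h
    have hmono : StrictMono (divExponent k) := fun m n hmn =>
      lt_of_le_of_ne ((divExponent_le_iff k m n).2 hmn.le)
        (fun e => hmn.ne (divExponent_injective k e))
    have hpwo : (Function.support fun n : ℤ => a.coeff (divExponent k n)).IsPWO := by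
      rw [Set.isPWO_iff_isWF]
      rw [Set.isWF_iff_no_descending_seq]
      intro f hf hmem
      exact (Set.isWF_iff_no_descending_seq.1 a.isWF_support) (fun i => divExponent k (f i))
        (fun i j hij => hmono (hf hij)) (fun i => hmem i)
    refine ⟨⟨fun n => a.coeff (divExponent k n), hpwo⟩, ?_⟩
    ext q
    by_cases hq : ∃ n : ℤ, divExponent k n = q
    · obtain ⟨n, rfl⟩ := hq
      exact laurentEmb_coeff k _ n
    · have h1 : a.coeff q = 0 := by
        by_contra hne
        exact hq (h q hne)
      rw [h1]
      by_contra hne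
      obtain ⟨n, -, hn⟩ := HahnSeries.support_embDomain_subset
        (show q ∈ (laurentEmb k _).support from hne)
      exact hq ⟨n, hn⟩

lemma fieldRange_laurentEmb_le_left (k l : ℕ) :
    (laurentEmb k).fieldRange ≤ (laurentEmb ((k + 1) * (l + 1) - 1)).fieldRange := by
  intro a ha
  rw [mem_range_laurentEmb_iff] at ha ⊢
  intro q hq
  obtain ⟨n, rfl⟩ := ha q hq
  refine ⟨n * ((l : ℤ) + 1), ?_⟩
  have hcast : ((((k + 1) * (l + 1) - 1 : ℕ) : ℚ)) + 1 = ((k : ℚ) + 1) * ((l : ℚ) + 1) := by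
    have : 1 ≤ (k + 1) * (l + 1) := Nat.one_le_iff_ne_zero.2 (by positivity)
    push_cast [Nat.cast_sub this]
    ring
  change (((n * ((l : ℤ) + 1) : ℤ)) : ℚ) / ((((k + 1) * (l + 1) - 1 : ℕ) : ℚ) + 1)
    = (n : ℚ) / ((k : ℚ) + 1)
  rw [hcast]
  have h1 : (k : ℚ) + 1 ≠ 0 := by positivity
  have h2 : (l : ℚ) + 1 ≠ 0 := by positivity
  push_cast
  field_simp

lemma fieldRange_laurentEmb_le_right (k l : ℕ) :
    (laurentEmb l).fieldRange ≤ (laurentEmb ((k + 1) * (l + 1) - 1)).fieldRange := by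
  rw [mul_comm]
  exact fieldRange_laurentEmb_le_left l k

/-- The field `ℂ((1/X))^* = ⋃ₖ ℂ((X ^ (-1 / k)))`, `k ≥ 1`, of formal Laurent–Puiseux series. -/
def laurentPuiseux : Subfield (HahnSeries ℚ ℂ) where
  carrier := {a | ∃ k : ℕ, a ∈ (laurentEmb k).fieldRange}
  zero_mem' := ⟨0, zero_mem _⟩
  one_mem' := ⟨0, one_mem _⟩
  add_mem' := fun ⟨k, hk⟩ ⟨l, hl⟩ => ⟨_, add_mem (fieldRange_laurentEmb_le_left k l hk)
    (fieldRange_laurentEmb_le_right k l hl)⟩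
  mul_mem' := fun ⟨k, hk⟩ ⟨l, hl⟩ => ⟨_, mul_mem (fieldRange_laurentEmb_le_left k l hk)
    (fieldRange_laurentEmb_le_right k l hl)⟩
  neg_mem' := fun ⟨k, hk⟩ => ⟨k, neg_mem hk⟩
  inv_mem' := fun _ ⟨k, hk⟩ => ⟨k, inv_mem hk⟩

lemma single_mem_laurentPuiseux (q : ℚ) (c : ℂ) : HahnSeries.single q c ∈ laurentPuiseux := by
  refine ⟨q.den - 1, (mem_range_laurentEmb_iff _ _).2 fun r hr => ⟨q.num, ?_⟩⟩
  have hrq : r = q := HahnSeries.support_single_subset hr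
  have hcast : ((q.den - 1 : ℕ) : ℚ) + 1 = q.den := by
    rw [Nat.cast_sub q.pos]; simp
  change (q.num : ℚ) / (((q.den - 1 : ℕ) : ℚ) + 1) = r
  rw [hcast, hrq, Rat.num_div_den]

namespace LaurentPuiseux

/-- The Laurent–Puiseux monomial `c X ^ θ`. -/
def mono (c : ℂ) (θ : ℚ) : laurentPuiseux :=
  ⟨HahnSeries.single (-θ) c, single_mem_laurentPuiseux _ _⟩

/-- The degree of a series: the largest exponent of `X`, and `-∞` for the zero series. -/
def deg (a : laurentPuiseux) : WithBot ℚ :=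
  open Classical in
  if a = 0 then ⊥ else ((-(a : HahnSeries ℚ ℂ).order : ℚ) : WithBot ℚ)

/-- The leading term `a⁺ = a₀ X ^ θ₀`; it is `0` for the zero series. -/
def leadingTerm (a : laurentPuiseux) : laurentPuiseux :=
  mono (a : HahnSeries ℚ ℂ).leadingCoeff (-(a : HahnSeries ℚ ℂ).order)

/-- Complex numbers as constant series. -/
def const : ℂ →+* laurentPuiseux :=
  (HahnSeries.C : ℂ →+* HahnSeries ℚ ℂ).codRestrict laurentPuiseux
    fun c => single_mem_laurentPuiseux 0 c

/-- The embedding `ℂ[X] → ℂ((1/X))^*`. -/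
def ofPoly : Polynomial ℂ →+* laurentPuiseux := Polynomial.eval₂RingHom const (mono 1 1)

end LaurentPuiseux

open LaurentPuiseux

/-! ### Solutions

A polynomial `h ∈ ℂ[X, Y]` is an element of `ℂ[X][Y]`; the coefficient of `X ^ α Y ^ β` is
`(h.coeff β).coeff α`. -/

/-- `h(X, Y)` viewed in `ℂ((1/X))^*[Y]`. -/
def toPuiseuxPoly (h : ℂ[X][Y]) : Polynomial laurentPuiseux := h.map ofPoly

/-- The substitution `h(X, a(X))`. -/
def substitution (h : ℂ[X][Y]) (a : laurentPuiseux) : laurentPuiseux := (toPuiseuxPoly h).eval a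

/-- `a(X)` is a solution of `h(X, Y) = 0`. -/
def IsSolution (h : ℂ[X][Y]) (a : laurentPuiseux) : Prop := substitution h a = 0

/-- The multiplicity of a solution `a(X)` of `h(X, Y) = 0`: the least `m > 0` such that
`(∂ᵐh/∂Yᵐ)(X, a(X)) ≠ 0`. -/
def solutionMult (h : ℂ[X][Y]) (a : laurentPuiseux) : ℕ :=
  sInf {m : ℕ | 0 < m ∧ substitution (Polynomial.derivative^[m] h) a ≠ 0}

/-! ### The right Newton polygon -/

/-- A non-degenerate segment with end points in `ℕ × ℕ`. -/
structure LatticeSegment where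
  fst : ℕ × ℕ
  snd : ℕ × ℕ
  ne : fst ≠ snd

/-- Lattice points as points of the plane, (abscissa, ordinate). -/
def latticePoint (p : ℕ × ℕ) : ℝ × ℝ := ((p.1 : ℝ), (p.2 : ℝ))

namespace LatticeSegment

/-- The points of the segment. -/
def toSet (S : LatticeSegment) : Set (ℝ × ℝ) :=
  segment ℝ (latticePoint S.fst) (latticePoint S.snd)

/-- The length `|S₁|` of the projection on the horizontal axis. -/
def len₁ (S : LatticeSegment) : ℕ := ((S.snd.1 : ℤ) - S.fst.1).natAbs

/-- The length `|S₂|` of the projection on the vertical axis. -/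
def len₂ (S : LatticeSegment) : ℕ := ((S.snd.2 : ℤ) - S.fst.2).natAbs

/-- The slope (meaningful for segments that are not vertical). -/
def slope (S : LatticeSegment) : ℚ :=
  ((S.snd.2 : ℚ) - S.fst.2) / ((S.snd.1 : ℚ) - S.fst.1)

/-- `σ(S)`: zero for a segment parallel to an axis, otherwise opposite to the sign of the slope. -/
def sigma (S : LatticeSegment) : ℚ :=
  if S.len₁ = 0 ∨ S.len₂ = 0 then 0 else if 0 < S.slope then -1 else 1

/-- The declivity (in a right polygon) `(|S₁| / |S₂|) σ(S)`. -/
def declivity (S : LatticeSegment) : ℚ := (S.len₁ : ℚ) / (S.len₂ : ℚ) * S.sigma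

end LatticeSegment

/-- The support `{(α, β) : h_{αβ} ≠ 0}`. -/
def newtonSupport (h : ℂ[X][Y]) : Finset (ℕ × ℕ) :=
  h.support.biUnion fun β => (h.coeff β).support.image fun α => (α, β)

lemma mem_newtonSupport (h : ℂ[X][Y]) (p : ℕ × ℕ) :
    p ∈ newtonSupport h ↔ (h.coeff p.2).coeff p.1 ≠ 0 := by
  obtain ⟨α, β⟩ := p
  simp only [newtonSupport, Finset.mem_biUnion, Finset.mem_image, Polynomial.mem_support_iff,
    Prod.mk.injEq]
  constructor
  · rintro ⟨b, -, a, ha, rfl, rfl⟩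
    exact ha
  · intro hne
    exact ⟨β, fun h0 => hne (by rw [h0]; simp), α, hne, rfl, rfl⟩

/-- The Newton diagram `Δ_h`: the convex hull of the support. -/
def newtonDiagram (h : ℂ[X][Y]) : Set (ℝ × ℝ) :=
  convexHull ℝ (latticePoint '' (newtonSupport h : Set (ℕ × ℕ)))

/-- The boundary segments: the one-dimensional faces of `Δ_h` (the end points of such a face lie
in the support, hence are lattice points). If `Δ_h` is itself a segment, it is the only one. -/
def boundarySegments (h : ℂ[X][Y]) : Set LatticeSegment :=
  {S | IsExposed ℝ (newtonDiagram h) S.toSet}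

/-- The right Newton polygon: the boundary segments on the right side of `Δ_h`, i.e. no point of
`Δ_h` lies strictly to the right of a point of `S` on the same horizontal line. A horizontal
segment never has this property, so these segments form the right part of the boundary, joining
the line `β = ord_Y h` with the line `β = deg_Y h`. -/
def rightNewtonPolygon (h : ℂ[X][Y]) : Set LatticeSegment :=
  {S | S ∈ boundarySegments h ∧
    ∀ p ∈ S.toSet, ∀ q ∈ newtonDiagram h, q.2 = p.2 → q.1 ≤ p.1}

/-- `in(h, S)`: the sum of the monomials `h_{αβ} X ^ α Y ^ β` with `(α, β) ∈ S`. -/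
def inForm (h : ℂ[X][Y]) (S : LatticeSegment) : ℂ[X][Y] :=
  open Classical in
  ∑ p ∈ newtonSupport h with latticePoint p ∈ S.toSet,
    Polynomial.monomial p.2 (Polynomial.monomial p.1 ((h.coeff p.2).coeff p.1))

end

open LaurentPuiseux

noncomputable section

/-! ### Hensel's lemma for factorizations over a power series ring -/

/-! Since Laurent–Puiseux series form an algebraically closed field (`LaurentPuiseux.isAlgClosed`),
`h` splits over it as `b ∏ (Y - aᵢ)`. Give `X` weight `1` and `Y` weight `θ`, and let the initial
form be the coefficient in `ℂ[Y]` of the highest power of `X` in `h(X, X^θ Y)`. It is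
multiplicative. On a factor `Y - a` it is `Y`, `Y - a₀` or a non-zero constant according as `deg a`
is below, equal to or above `θ`. So its non-zero roots are the leading coefficients of the solutions
of degree `θ`, with multiplicity (`initialForm_countP_roots`).

The same polynomial can be read from the support: it is the sum of the terms of maximal weight `α +
θβ`, with `X = 1`. When `θ` is the declivity of a segment `S` of the right polygon, these terms are
exactly those on `S` (`initialForm_declivity`), and degree minus order at `0` is `|S₂|`; this gives
(b). Conversely a solution of degree `θ` gives the initial form a non-zero root, so it is not a
monomial; the supporting line of weight `θ` then meets the support at two heights and cuts out a
segment (`exists_mem_rightNewtonPolygon_of_isRoot`); this gives (a).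

Algebraic closedness follows from Hensel's lemma: a monic polynomial of degree at least `2` is
translated to kill its second coefficient, then rescaled by a power of `X` so that its reduction is
defined and is not `Y^n`. Unless only `Y^n` was left, the reduction has a coprime factorization,
which lifts. -/

/-- Bézout gives some solution; reducing its first component modulo `g` bounds the second one too,
by comparing degrees in `g * p.2 = R - p.1 * h`. -/
lemma Polynomial.exists_mul_add_mul_eq_of_isCoprime {F : Type*} [Field F] {g h R : Polynomial F}
    (hg : g.Monic) (hgh : IsCoprime g h) (hR : R.degree < (g * h).degree) :
    ∃ p : Polynomial F × Polynomial F,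
      p.1 * h + g * p.2 = R ∧ p.1.degree < g.degree ∧ p.2.degree < h.degree := by
  obtain ⟨a, b, hab⟩ := hgh
  have hu : (R * b %ₘ g).degree < g.degree := Polynomial.degree_modByMonic_lt _ hg
  have hdiv := Polynomial.modByMonic_add_div (R * b) g
  have heq : (R * b %ₘ g) * h + g * (R * a + (R * b /ₘ g) * h) = R := by
    linear_combination h * hdiv + R * hab
  refine ⟨(_, _), heq, hu, ?_⟩
  by_contra! hlt
  have h1 : (g * h).degree ≤ (g * (R * a + (R * b /ₘ g) * h)).degree := by
    rw [Polynomial.degree_mul, Polynomial.degree_mul]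
    gcongr
  have hh0 : h ≠ 0 := by
    rintro rfl
    simp at hR
  have h2 : ((R * b %ₘ g) * h).degree < (g * h).degree := by
    rw [Polynomial.degree_mul, Polynomial.degree_mul]
    exact WithBot.add_lt_add_right (Polynomial.degree_ne_bot.2 hh0) hu
  have h3 : g * (R * a + (R * b /ₘ g) * h) = R - (R * b %ₘ g) * h := by
    linear_combination heq
  rw [h3] at h1
  exact absurd (h1.trans (Polynomial.degree_sub_le _ _)) (not_le.2 (max_lt hR h2))

/-- The recursion that lifts a factorization coefficient by coefficient, where `solve` solves the
linearized equation. -/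
def henselSeq {A : Type*} [CommRing A] (solve : A → A × A) (F : ℕ → A) (p : A × A) : ℕ → A × A
  | 0 => p
  | n + 1 => solve (F (n + 1) -
      ∑ i : Fin n, (henselSeq solve F p (i + 1)).1 * (henselSeq solve F p (n - i)).2)

/-- At order `n + 1` the equation `u * v = f` reads `uₙ₊₁ h + g vₙ₊₁ = fₙ₊₁ - ∑ uᵢ vⱼ` over positive
`i`, `j` with `i + j = n + 1`. The degree bounds already obtained keep the right side below `deg (g
* h)`, so this linear equation is solvable at every order. -/
lemma PowerSeries.exists_factorization_of_isCoprime {F : Type*} [Field F]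
    (f : PowerSeries (Polynomial F)) {g h : Polynomial F} (hg : g.Monic) (hh : h.Monic)
    (hgh : IsCoprime g h) (h0 : PowerSeries.coeff 0 f = g * h)
    (hf : ∀ n, (PowerSeries.coeff (n + 1) f).degree < (g * h).degree) :
    ∃ u v : PowerSeries (Polynomial F), u * v = f ∧
      PowerSeries.coeff 0 u = g ∧ PowerSeries.coeff 0 v = h ∧
      (∀ n, (PowerSeries.coeff (n + 1) u).degree < g.degree) ∧
      ∀ n, (PowerSeries.coeff (n + 1) v).degree < h.degree := by
  classical
  -- The degree condition sits inside the existential so that `solve` is a total function, usable in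
  -- the recursion before the bounds are known.
  have hsolve : ∀ R : Polynomial F, ∃ p : Polynomial F × Polynomial F,
      R.degree < (g * h).degree →
      p.1 * h + g * p.2 = R ∧ p.1.degree < g.degree ∧ p.2.degree < h.degree := by
    intro R
    by_cases hR : R.degree < (g * h).degree
    · obtain ⟨p, hp⟩ := Polynomial.exists_mul_add_mul_eq_of_isCoprime hg hgh hR
      exact ⟨p, fun _ => hp⟩
    · exact ⟨0, fun h => absurd h hR⟩
  choose solve hsolve using hsolve
  set s := henselSeq solve (fun n => PowerSeries.coeff n f) (g, h) with hs
  have hs0 : s 0 = (g, h) := by rw [hs, henselSeq]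
  have hs1 : ∀ n, s (n + 1) = solve (PowerSeries.coeff (n + 1) f -
      ∑ i : Fin n, (s (i + 1)).1 * (s (n - i)).2) := by
    intro n
    rw [hs, henselSeq]
  have key : ∀ n, (s (n + 1)).1 * h + g * (s (n + 1)).2 = PowerSeries.coeff (n + 1) f -
      ∑ i : Fin n, (s (i + 1)).1 * (s (n - i)).2 ∧
      (s (n + 1)).1.degree < g.degree ∧ (s (n + 1)).2.degree < h.degree := by
    intro n
    induction n using Nat.strong_induction_on with
    | _ n ih =>
      have hR : (PowerSeries.coeff (n + 1) f -
          ∑ i : Fin n, (s (i + 1)).1 * (s (n - i)).2).degree < (g * h).degree := by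
        refine (Polynomial.degree_sub_le _ _).trans_lt (max_lt (hf n) ?_)
        refine (Polynomial.degree_sum_le _ _).trans_lt ?_
        rw [Finset.sup_lt_iff (bot_lt_iff_ne_bot.2 (Polynomial.degree_ne_bot.2
          (mul_ne_zero hg.ne_zero hh.ne_zero)))]
        intro i _
        have h1 := (ih i i.2).2.1
        have h2 := (ih (n - i - 1) (by omega)).2.2
        rw [show n - (i : ℕ) - 1 + 1 = n - i by omega] at h2
        rw [Polynomial.degree_mul, Polynomial.degree_mul]
        exact (add_le_add_left h1.le _).trans_lt
          (WithBot.add_lt_add_left (Polynomial.degree_ne_bot.2 hg.ne_zero) h2)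
      rw [hs1]
      exact hsolve _ hR
  refine ⟨PowerSeries.mk fun n => (s n).1, PowerSeries.mk fun n => (s n).2, ?_, ?_, ?_, ?_, ?_⟩
  · ext1 n
    rw [PowerSeries.coeff_mul]
    simp only [PowerSeries.coeff_mk]
    rcases n with _ | n
    · simp [hs0, h0]
    · rw [Finset.Nat.sum_antidiagonal_eq_sum_range_succ (fun i j => (s i).1 * (s j).2),
        Finset.sum_range_succ, Finset.sum_range_succ']
      have h1 := (key n).1
      rw [Finset.sum_fin_eq_sum_range] at h1
      simp only [hs0, Nat.sub_self, Nat.sub_zero]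
      rw [eq_sub_iff_add_eq] at h1
      rw [← h1]
      have h2 : ∑ k ∈ Finset.range n, (s (k + 1)).1 * (s (n + 1 - (k + 1))).2 =
          ∑ i ∈ Finset.range n, if hi : i < n then (s (i + 1)).1 * (s (n - i)).2 else 0 := by
        refine Finset.sum_congr rfl fun i hi => ?_
        rw [dif_pos (Finset.mem_range.1 hi), Nat.add_sub_add_right]
      rw [h2]
      ring
  · simp [hs0]
  · simp [hs0]
  · intro n
    simpa using (key n).2.1
  · intro n
    simpa using (key n).2.2

/-- A polynomial with power series coefficients as a power series with polynomial coefficients. -/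
def Polynomial.toPowerSeriesPoly (F : Type*) [CommRing F] :
    Polynomial (PowerSeries F) →+* PowerSeries (Polynomial F) :=
  Polynomial.eval₂RingHom (PowerSeries.map Polynomial.C) (PowerSeries.C Polynomial.X)

lemma Polynomial.coeff_coeff_toPowerSeriesPoly {F : Type*} [CommRing F]
    (f : Polynomial (PowerSeries F)) (n i : ℕ) :
    (PowerSeries.coeff n (Polynomial.toPowerSeriesPoly F f)).coeff i =
      PowerSeries.coeff n (f.coeff i) := by
  induction f using Polynomial.induction_on' with
  | add p q hp hq => simp [hp, hq]
  | monomial m a =>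
    rw [Polynomial.toPowerSeriesPoly, Polynomial.coe_eval₂RingHom, Polynomial.eval₂_monomial,
      ← map_pow, mul_comm, PowerSeries.coeff_C_mul, PowerSeries.coeff_map, mul_comm,
      Polynomial.coeff_C_mul_X_pow, Polynomial.coeff_monomial]
    simp only [eq_comm (a := i)]
    split_ifs <;> simp

lemma Polynomial.toPowerSeriesPoly_injective (F : Type*) [CommRing F] :
    Function.Injective (Polynomial.toPowerSeriesPoly F) := by
  intro f g hfg
  ext i n
  rw [← Polynomial.coeff_coeff_toPowerSeriesPoly, hfg, Polynomial.coeff_coeff_toPowerSeriesPoly]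

/-- The degrees in the polynomial variable are bounded uniformly in `n`, so the two variables can be
exchanged. Only the constant term reaches degree `r`, hence the leading coefficient is the series
`1`. -/
lemma PowerSeries.exists_toPowerSeriesPoly_eq {F : Type*} [Field F] (u : PowerSeries (Polynomial F))
    {g : Polynomial F} (hg : g.Monic) (h0 : PowerSeries.coeff 0 u = g)
    (hu : ∀ n, (PowerSeries.coeff (n + 1) u).degree < g.degree) :
    ∃ f : Polynomial (PowerSeries F), Polynomial.toPowerSeriesPoly F f = u ∧ f.Monic ∧
      f.natDegree = g.natDegree := by
  set r := g.natDegree with hr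
  have hbig : ∀ n i, r < i → (PowerSeries.coeff n u).coeff i = 0 := by
    intro n i hi
    apply Polynomial.coeff_eq_zero_of_natDegree_lt
    rcases n with _ | n
    · rwa [h0]
    · exact (Polynomial.natDegree_le_natDegree (hu n).le).trans_lt hi
  let f : Polynomial (PowerSeries F) := ∑ i ∈ Finset.range (r + 1),
    Polynomial.monomial i (PowerSeries.mk fun n => (PowerSeries.coeff n u).coeff i)
  have hcoeff : ∀ i, f.coeff i = PowerSeries.mk fun n => (PowerSeries.coeff n u).coeff i := by
    intro i
    simp only [f, Polynomial.finsetSum_coeff, Polynomial.coeff_monomial]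
    rw [Finset.sum_ite_eq']
    split_ifs with hi
    · rfl
    · ext n
      simp [hbig n i (by simpa using hi)]
  have hdeg : f.natDegree ≤ r := by
    refine Polynomial.natDegree_le_iff_coeff_eq_zero.2 fun i hi => ?_
    rw [hcoeff]
    ext n
    simp [hbig n i hi]
  have hlead : f.coeff r = 1 := by
    rw [hcoeff]
    ext n
    rw [PowerSeries.coeff_mk, PowerSeries.coeff_one]
    rcases n with _ | n
    · rw [h0, hr]
      simpa using hg.leadingCoeff
    · rw [if_neg (by omega)]
      apply Polynomial.coeff_eq_zero_of_degree_lt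
      rw [hr, ← Polynomial.degree_eq_natDegree hg.ne_zero]
      exact hu n
  refine ⟨f, ?_, Polynomial.monic_of_natDegree_le_of_coeff_eq_one r hdeg hlead, ?_⟩
  · ext n i
    rw [Polynomial.coeff_coeff_toPowerSeriesPoly, hcoeff, PowerSeries.coeff_mk]
  · refine le_antisymm hdeg (Polynomial.le_natDegree_of_ne_zero ?_)
    rw [hlead]
    exact one_ne_zero

/-- **Hensel's lemma**: a factorization of the reduction of a monic polynomial over `F⟦T⟧` into
coprime monic factors lifts. -/
theorem PowerSeries.hensel_factorization {F : Type*} [Field F] {f : Polynomial (PowerSeries F)}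
    (hf : f.Monic) {g h : Polynomial F} (hg : g.Monic) (hh : h.Monic) (hgh : IsCoprime g h)
    (hred : f.map PowerSeries.constantCoeff = g * h) :
    ∃ u v : Polynomial (PowerSeries F), f = u * v ∧ u.Monic ∧ v.Monic ∧
      u.natDegree = g.natDegree ∧ v.natDegree = h.natDegree := by
  have hdeg : (g * h).degree = (f.natDegree : WithBot ℕ) := by
    rw [← hred, hf.degree_map, Polynomial.degree_eq_natDegree hf.ne_zero]
  obtain ⟨u, v, huv, hu0, hv0, hu, hv⟩ := PowerSeries.exists_factorization_of_isCoprime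
    (Polynomial.toPowerSeriesPoly F f) hg hh hgh
    (by
      rw [← hred]
      ext i
      rw [Polynomial.coeff_coeff_toPowerSeriesPoly, Polynomial.coeff_map,
        PowerSeries.coeff_zero_eq_constantCoeff_apply])
    (by
      intro n
      rw [hdeg, Polynomial.degree_lt_iff_coeff_zero]
      intro i hi
      rw [Polynomial.coeff_coeff_toPowerSeriesPoly]
      rcases hi.eq_or_lt with rfl | hi
      · rw [hf.coeff_natDegree, PowerSeries.coeff_one, if_neg (by omega)]
      · rw [Polynomial.coeff_eq_zero_of_natDegree_lt hi, map_zero])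
  obtain ⟨U, rfl, hU, hUd⟩ := PowerSeries.exists_toPowerSeriesPoly_eq u hg hu0 hu
  obtain ⟨V, rfl, hV, hVd⟩ := PowerSeries.exists_toPowerSeriesPoly_eq v hh hv0 hv
  refine ⟨U, V, Polynomial.toPowerSeriesPoly_injective F ?_, hU, hV, hUd, hVd⟩
  rw [map_mul, huv]

/-! ### The field of Laurent–Puiseux series is algebraically closed -/

/-- The embedding `ℂ⟦T⟧ → ℂ((1/X))^*`, `T ↦ X ^ (-1 / (k + 1))`. -/
def powerSeriesEmb (k : ℕ) : PowerSeries ℂ →+* laurentPuiseux :=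
  ((laurentEmb k).comp (HahnSeries.ofPowerSeries ℤ ℂ)).codRestrict laurentPuiseux
    fun _ => ⟨k, _, rfl⟩

lemma exists_powerSeriesEmb_eq {k : ℕ} {a : laurentPuiseux}
    (ha : (a : HahnSeries ℚ ℂ) ∈ (laurentEmb k).fieldRange)
    (hneg : ∀ q < 0, (a : HahnSeries ℚ ℂ).coeff q = 0) : ∃ x, powerSeriesEmb k x = a := by
  obtain ⟨p, hp⟩ := ha
  refine ⟨PowerSeries.mk fun n => p.coeff n, Subtype.ext ?_⟩
  change laurentEmb k (HahnSeries.ofPowerSeries ℤ ℂ _) = _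
  rw [← hp]
  congr 1
  ext m
  rw [PowerSeries.coeff_coe]
  split_ifs with hm
  · rw [← laurentEmb_coeff k, hp, hneg]
    change (m : ℚ) / ((k : ℚ) + 1) < 0
    exact div_neg_of_neg_of_pos (by exact_mod_cast hm) (by positivity)
  · rw [PowerSeries.coeff_mk, Int.natAbs_of_nonneg (not_lt.1 hm)]

lemma coeff_zero_powerSeriesEmb (k : ℕ) (x : PowerSeries ℂ) :
    (powerSeriesEmb k x : HahnSeries ℚ ℂ).coeff 0 = PowerSeries.constantCoeff x := by
  change (laurentEmb k (HahnSeries.ofPowerSeries ℤ ℂ x)).coeff 0 = _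
  rw [← map_zero (divExponent k), laurentEmb_coeff, PowerSeries.coeff_coe]
  simp

lemma exists_forall_mem_fieldRange_laurentEmb (s : Finset laurentPuiseux) :
    ∃ k, ∀ a ∈ s, (a : HahnSeries ℚ ℂ) ∈ (laurentEmb k).fieldRange := by
  classical
  induction s using Finset.induction_on with
  | empty => exact ⟨0, by simp⟩
  | insert a s _ ih =>
    obtain ⟨k, hk⟩ := ih
    obtain ⟨l, hl⟩ := a.2
    refine ⟨(k + 1) * (l + 1) - 1, fun b hb => ?_⟩
    rcases Finset.mem_insert.1 hb with rfl | hb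
    · exact fieldRange_laurentEmb_le_right k l hl
    · exact fieldRange_laurentEmb_le_left k l (hk b hb)

/-- Split off the full power of `X - c` at a root `c`. If nothing were left, `f = (X - c)^n` would
have second coefficient `-n c`; in characteristic zero its vanishing forces `c = 0` and `f = X^n`,
against `hfi`. -/
lemma Polynomial.exists_coprime_factorization {F : Type*} [Field F] [IsAlgClosed F] [CharZero F]
    {f : Polynomial F} (hf : f.Monic) (hn : 2 ≤ f.natDegree) (h1 : f.coeff (f.natDegree - 1) = 0)
    {i : ℕ} (hi : i < f.natDegree) (hfi : f.coeff i ≠ 0) :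
    ∃ g h : Polynomial F, f = g * h ∧ g.Monic ∧ h.Monic ∧ IsCoprime g h ∧
      g.natDegree ≠ 0 ∧ h.natDegree ≠ 0 := by
  obtain ⟨c, hc⟩ := IsAlgClosed.exists_root f
    (by rw [Polynomial.degree_eq_natDegree hf.ne_zero]; norm_cast; omega)
  obtain ⟨q, hq, hcq⟩ := Polynomial.exists_eq_pow_rootMultiplicity_mul_and_not_dvd f hf.ne_zero c
  set m := Polynomial.rootMultiplicity c f with hm
  have hmpos : 0 < m := (Polynomial.rootMultiplicity_pos hf.ne_zero).2 hc
  have hpow : ((Polynomial.X - Polynomial.C c) ^ m).Monic := (Polynomial.monic_X_sub_C c).pow m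
  have hqm : q.Monic := hpow.of_mul_monic_left (hq ▸ hf)
  refine ⟨_, q, hq, hpow, hqm, ?_, ?_, ?_⟩
  · exact (((Polynomial.irreducible_X_sub_C c).coprime_iff_not_dvd).2 hcq).pow_left
  · rw [Polynomial.natDegree_pow, Polynomial.natDegree_X_sub_C]
    omega
  · intro hq0
    rw [hqm.natDegree_eq_zero.1 hq0, mul_one] at hq
    have hmn : f.natDegree = m := by
      rw [hq, Polynomial.natDegree_pow, Polynomial.natDegree_X_sub_C, mul_one]
    rw [hmn] at h1 hi hn
    have h2 : c = 0 := by
      rw [hq, sub_eq_add_neg, ← Polynomial.C_neg, Polynomial.coeff_X_add_C_pow] at h1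
      rw [show m - (m - 1) = 1 by omega, pow_one, mul_eq_zero, neg_eq_zero] at h1
      refine h1.resolve_right ?_
      exact Nat.cast_ne_zero.2 (Nat.choose_pos (by omega)).ne'
    rw [hq, h2, Polynomial.C_0, sub_zero, Polynomial.coeff_X_pow, if_neg hi.ne] at hfi
    exact hfi rfl

namespace LaurentPuiseux

/-- The coefficients contain no positive power of `X`, so with a common denominator `k + 1` they are
power series in `T = X^(-1/(k+1))`. Reduction modulo `T` picks the coefficients at exponent `0`, and
Hensel's lemma lifts its coprime factorization. -/
lemma exists_factorization_of_coeff_nonneg {f : Polynomial laurentPuiseux} (hf : f.Monic)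
    (hn : 2 ≤ f.natDegree) (h1 : f.coeff (f.natDegree - 1) = 0)
    (hneg : ∀ i, ∀ q < 0, (f.coeff i : HahnSeries ℚ ℂ).coeff q = 0)
    {i : ℕ} (hi : i < f.natDegree) (hfi : (f.coeff i : HahnSeries ℚ ℂ).coeff 0 ≠ 0) :
    ∃ u v : Polynomial laurentPuiseux, f = u * v ∧ u.Monic ∧ v.Monic ∧
      u.natDegree ≠ 0 ∧ v.natDegree ≠ 0 := by
  classical
  obtain ⟨k, hk⟩ := exists_forall_mem_fieldRange_laurentEmb (f.support.image f.coeff)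
  have hlift : f ∈ Polynomial.lifts (powerSeriesEmb k) := by
    rw [Polynomial.lifts_iff_coeff_lifts]
    intro j
    by_cases hj : f.coeff j = 0
    · exact ⟨0, by rw [hj, map_zero]⟩
    · exact exists_powerSeriesEmb_eq (hk _ (Finset.mem_image_of_mem _
        (Polynomial.mem_support_iff.2 hj))) (hneg j)
  obtain ⟨F, rfl, hFn, hF⟩ := Polynomial.lifts_and_natDegree_eq_and_monic hlift hf
  have hcoeff : ∀ j, (F.map PowerSeries.constantCoeff).coeff j =
      ((F.map (powerSeriesEmb k)).coeff j : HahnSeries ℚ ℂ).coeff 0 := by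
    intro j
    rw [Polynomial.coeff_map, Polynomial.coeff_map, coeff_zero_powerSeriesEmb]
  have hdeg : (F.map PowerSeries.constantCoeff).natDegree =
      (F.map (powerSeriesEmb k)).natDegree := by
    rw [hF.natDegree_map, hFn]
  obtain ⟨g, h, hgh, hg, hh, hco, hg0, hh0⟩ := Polynomial.exists_coprime_factorization
    (hF.map PowerSeries.constantCoeff) (hdeg ▸ hn)
    (by rw [hdeg, hcoeff, h1]; rfl) (hdeg ▸ hi) (by rwa [hcoeff])
  obtain ⟨u, v, huv, hu, hv, hud, hvd⟩ := PowerSeries.hensel_factorization hF hg hh hco hgh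
  refine ⟨u.map _, v.map _, by rw [huv, Polynomial.map_mul], hu.map _, hv.map _, ?_, ?_⟩
  · rwa [hu.natDegree_map, hud]
  · rwa [hv.natDegree_map, hvd]

lemma mono_ne_zero {c : ℂ} (hc : c ≠ 0) (θ : ℚ) : mono c θ ≠ 0 := by
  intro h
  exact HahnSeries.single_ne_zero (a := -θ) hc (congrArg Subtype.val h)

lemma coe_mono_pow (c : ℂ) (θ : ℚ) (n : ℕ) :
    ((mono c θ ^ n : laurentPuiseux) : HahnSeries ℚ ℂ) =
      HahnSeries.single (-(n * θ)) (c ^ n) := by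
  change (HahnSeries.single (-θ) c) ^ n = _
  rw [HahnSeries.single_pow]
  simp

/-- Multiplying the roots by `X^r` lowers the Hahn order of the coefficient `j` by `(n - j) r`. For
`r` the least value of `order / (n - j)`, a slope of the Newton polygon, all orders become
non-negative and one with `j < n` becomes zero. -/
lemma exists_factorization_of_coeff_ne_zero {f : Polynomial laurentPuiseux} (hf : f.Monic)
    (hn : 2 ≤ f.natDegree) (h1 : f.coeff (f.natDegree - 1) = 0)
    (hne : ∃ i < f.natDegree, f.coeff i ≠ 0) :
    ∃ u v : Polynomial laurentPuiseux, f = u * v ∧ u.Monic ∧ v.Monic ∧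
      u.natDegree ≠ 0 ∧ v.natDegree ≠ 0 := by
  classical
  set n := f.natDegree with hnd
  obtain ⟨i, hi, hmin⟩ := Finset.exists_min_image
    ((Finset.range n).filter fun i => f.coeff i ≠ 0)
    (fun i => (f.coeff i : HahnSeries ℚ ℂ).order / ((n : ℚ) - i))
    (by
      obtain ⟨i, hi, hfi⟩ := hne
      exact ⟨i, by simp [hi, hfi]⟩)
  set r : ℚ := (f.coeff i : HahnSeries ℚ ℂ).order / ((n : ℚ) - i) with hr
  simp only [Finset.mem_filter, Finset.mem_range, and_imp] at hi hmin
  set s := mono 1 r with hs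
  have hs0 : s ≠ 0 := mono_ne_zero one_ne_zero r
  have hcoeff : ∀ j ≤ n, ∀ q, ((f.scaleRoots s).coeff j : HahnSeries ℚ ℂ).coeff q =
      (f.coeff j : HahnSeries ℚ ℂ).coeff (q + ((n : ℚ) - j) * r) := by
    intro j hj q
    rw [Polynomial.coeff_scaleRoots, MulMemClass.coe_mul, coe_mono_pow, one_pow, ← hnd]
    have h := HahnSeries.coeff_mul_single_add (r := (1 : ℂ))
      (x := (f.coeff j : HahnSeries ℚ ℂ)) (a := q + ((n : ℚ) - j) * r)
      (b := -(((n - j : ℕ) : ℚ) * r))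
    rw [mul_one] at h
    rw [← h, Nat.cast_sub hj]
    congr 1
    ring
  have hdeg : (f.scaleRoots s).natDegree = n := Polynomial.natDegree_scaleRoots f s
  obtain ⟨u, v, huv, hu, hv, hu0, hv0⟩ := exists_factorization_of_coeff_nonneg
    (f := f.scaleRoots s) ((Polynomial.monic_scaleRoots_iff s).2 hf)
    (by rwa [hdeg])
    (by rw [hdeg, Polynomial.coeff_scaleRoots, h1, zero_mul])
    (by
      intro j q hq
      rcases lt_trichotomy j n with hj | rfl | hj
      · rw [hcoeff j hj.le]
        by_cases h0 : f.coeff j = 0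
        · rw [h0]
          rfl
        · apply HahnSeries.coeff_eq_zero_of_lt_order
          have hpos : (0 : ℚ) < (n : ℚ) - j := sub_pos.2 (by exact_mod_cast hj)
          have h2 := hmin j hj h0
          rw [le_div_iff₀ hpos] at h2
          linarith
      · rw [hcoeff n le_rfl, hnd, hf.coeff_natDegree]
        simp only [sub_self, zero_mul, add_zero]
        exact (HahnSeries.coeff_one (Γ := ℚ) (R := ℂ) (a := q)).trans (if_neg hq.ne)
      · rw [Polynomial.coeff_eq_zero_of_natDegree_lt (hdeg ▸ hj)]
        rfl)
    (i := i) (hdeg ▸ hi.1)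
    (by
      have hpos : (0 : ℚ) < (n : ℚ) - i := sub_pos.2 (by exact_mod_cast hi.1)
      rw [hcoeff i hi.1.le, hr, zero_add, mul_div_cancel₀ _ hpos.ne', Ne,
        HahnSeries.coeff_order_eq_zero]
      exact fun h => hi.2 (Subtype.ext h))
  refine ⟨u.scaleRoots s⁻¹, v.scaleRoots s⁻¹, ?_, (Polynomial.monic_scaleRoots_iff _).2 hu,
    (Polynomial.monic_scaleRoots_iff _).2 hv, ?_, ?_⟩
  · rw [← Polynomial.mul_scaleRoots_of_noZeroDivisors, ← huv, ← Polynomial.scaleRoots_mul,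
      mul_inv_cancel₀ hs0, Polynomial.scaleRoots_one]
  · rwa [Polynomial.natDegree_scaleRoots]
  · rwa [Polynomial.natDegree_scaleRoots]

end LaurentPuiseux

/-- Tschirnhaus translation: the second coefficient of `f(X + r)` is `n r + fₙ₋₁`, and `n` is
invertible. -/
lemma Polynomial.exists_coeff_taylor_eq_zero {F : Type*} [Field F] [CharZero F] {f : Polynomial F}
    (hf : f.Monic) (hn : f.natDegree ≠ 0) :
    ∃ r, (Polynomial.taylor r f).coeff (f.natDegree - 1) = 0 := by
  set n := f.natDegree with hnd
  have hn0 : (n : F) ≠ 0 := Nat.cast_ne_zero.2 hn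
  refine ⟨-(f.coeff (n - 1)) / n, ?_⟩
  have hle : (Polynomial.hasseDeriv (n - 1) f).natDegree ≤ 1 :=
    (Polynomial.natDegree_hasseDeriv_le f (n - 1)).trans (by omega)
  rw [Polynomial.taylor_coeff, Polynomial.eq_X_add_C_of_natDegree_le_one hle,
    Polynomial.hasseDeriv_coeff, Polynomial.hasseDeriv_coeff, zero_add, Nat.choose_self,
    show 1 + (n - 1) = n by omega, Nat.choose_symm (by omega : 1 ≤ n), Nat.choose_one_right,
    hnd, hf.coeff_natDegree, ← hnd]
  simp
  field_simp
  ring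

instance LaurentPuiseux.charZero : CharZero laurentPuiseux :=
  charZero_of_injective_ringHom const.injective

/-- **The Newton–Puiseux theorem.** -/
instance LaurentPuiseux.isAlgClosed : IsAlgClosed laurentPuiseux := by
  refine IsAlgClosed.of_exists_root _ fun p hp hirr => ?_
  by_cases hn : p.natDegree = 1
  · exact Polynomial.exists_root_of_degree_eq_one
      (by rw [Polynomial.degree_eq_natDegree hp.ne_zero, hn]; rfl)
  exfalso
  have hn2 : 2 ≤ p.natDegree := by
    have := hirr.natDegree_pos
    omega
  obtain ⟨r, hr⟩ := Polynomial.exists_coeff_taylor_eq_zero hp (by omega)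
  have hirr' : Irreducible (Polynomial.taylor r p) :=
    (MulEquiv.irreducible_iff (Polynomial.taylorEquiv r)).2 hirr
  have hdeg := Polynomial.natDegree_taylor p r
  have hmon : (Polynomial.taylor r p).Monic := by
    rw [Polynomial.Monic, Polynomial.leadingCoeff_taylor, hp.leadingCoeff]
  generalize Polynomial.taylor r p = f at *
  rw [← hdeg] at hr hn2
  by_cases hne : ∃ i < f.natDegree, f.coeff i ≠ 0
  · obtain ⟨u, v, huv, hu, hv, hu0, hv0⟩ :=
      LaurentPuiseux.exists_factorization_of_coeff_ne_zero hmon hn2 hr hne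
    rcases (hmon.irreducible_iff_natDegree.1 hirr').2 u v hu hv huv.symm with h | h
    · exact hu0 h
    · exact hv0 h
  -- With all lower coefficients zero, the translated polynomial is a proper power of `X`.
  · push Not at hne
    have hX : f = Polynomial.X ^ f.natDegree := by
      ext1 i
      rw [Polynomial.coeff_X_pow]
      split_ifs with hi
      · rw [hi, hmon.coeff_natDegree]
      · rcases lt_or_gt_of_ne hi with h | h
        · exact hne i h
        · exact Polynomial.coeff_eq_zero_of_natDegree_lt h
    rw [hX] at hirr'
    exact not_irreducible_pow (by omega) hirr'

/-! ### Initial forms -/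

namespace HahnSeries

/-- A ring homomorphism applied to the coefficients of a Hahn series. -/
def mapCoeffRingHom (Γ : Type*) [AddCommMonoid Γ] [PartialOrder Γ] [IsOrderedCancelAddMonoid Γ]
    {R S : Type*} [Semiring R] [Semiring S] (f : R →+* S) : HahnSeries Γ R →+* HahnSeries Γ S where
  toFun a := a.map f
  map_zero' := by ext; simp
  map_one' := HahnSeries.map_one f.toMonoidWithZeroHom
  map_add' a b := by ext; simp
  map_mul' a b := HahnSeries.map_mul f.toNonUnitalRingHom

lemma leadingCoeff_eq_coeff {Γ R : Type*} [LinearOrder Γ] [Zero Γ] [Zero R] {x : HahnSeries Γ R}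
    {g : Γ} (hg : x.coeff g ≠ 0) (hlt : ∀ g' < g, x.coeff g' = 0) :
    x.leadingCoeff = x.coeff g := by
  rw [leadingCoeff_eq]
  congr 1
  refine le_antisymm (order_le_of_coeff_ne_zero hg) (not_lt.1 fun h => ?_)
  have h0 := coeff_order_eq_zero.1 (hlt _ h)
  rw [h0] at hg
  exact hg rfl

end HahnSeries

namespace LaurentPuiseux

/-- The ring homomorphism `P(X, Y) ↦ P(X, X ^ θ Y)`, with values in the ring of series in `X` whose
coefficients are polynomials in `Y`. -/
def weightedEmb (θ : ℚ) : Polynomial laurentPuiseux →+* HahnSeries ℚ (Polynomial ℂ) :=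
  Polynomial.eval₂RingHom
    ((HahnSeries.mapCoeffRingHom ℚ (Polynomial.C : ℂ →+* Polynomial ℂ)).comp laurentPuiseux.subtype)
    (HahnSeries.single (-θ) Polynomial.X)

/-- The initial form of `P(X, Y)` for the weights `1` of `X` and `θ` of `Y`, dehomogenized: the
coefficient of the highest power of `X` in `P(X, X ^ θ Y)`. -/
def initialForm (θ : ℚ) (P : Polynomial laurentPuiseux) : Polynomial ℂ :=
  (weightedEmb θ P).leadingCoeff

/-- The coefficient ring `ℂ[Y]` is a domain, so leading coefficients of Hahn series multiply. -/
lemma initialForm_mul (θ : ℚ) (P Q : Polynomial laurentPuiseux) :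
    initialForm θ (P * Q) = initialForm θ P * initialForm θ Q := by
  rw [initialForm, map_mul, HahnSeries.leadingCoeff_mul]
  rfl

lemma coeff_weightedEmb_monomial (θ : ℚ) (n : ℕ) (a : laurentPuiseux) (q : ℚ) :
    (weightedEmb θ (Polynomial.monomial n a)).coeff q =
      Polynomial.monomial n ((a : HahnSeries ℚ ℂ).coeff (q + n * θ)) := by
  rw [weightedEmb, Polynomial.coe_eval₂RingHom, Polynomial.eval₂_monomial, HahnSeries.single_pow]
  have h := HahnSeries.coeff_mul_single_add (r := (Polynomial.X : Polynomial ℂ) ^ n)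
    (x := (a : HahnSeries ℚ ℂ).map (Polynomial.C : ℂ →+* Polynomial ℂ)) (a := q + n * θ)
    (b := n • (-θ))
  rw [show q + n * θ + n • (-θ) = q by rw [nsmul_eq_mul]; ring] at h
  rw [HahnSeries.map_coeff] at h
  exact h.trans Polynomial.C_mul_X_pow_eq_monomial

lemma coeff_weightedEmb_C (θ : ℚ) (a : laurentPuiseux) (q : ℚ) :
    (weightedEmb θ (Polynomial.C a)).coeff q = Polynomial.C ((a : HahnSeries ℚ ℂ).coeff q) := by
  simpa using coeff_weightedEmb_monomial θ 0 a q

lemma coeff_weightedEmb_X_sub_C (θ : ℚ) (a : laurentPuiseux) (q : ℚ) :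
    (weightedEmb θ (Polynomial.X - Polynomial.C a)).coeff q =
      (if q = -θ then Polynomial.X else 0) - Polynomial.C ((a : HahnSeries ℚ ℂ).coeff q) := by
  rw [map_sub, HahnSeries.coeff_sub, coeff_weightedEmb_C]
  congr 1
  rw [weightedEmb, Polynomial.coe_eval₂RingHom, Polynomial.eval₂_X, HahnSeries.coeff_single]
  split_ifs <;> rfl

lemma initialForm_C_ne_zero (θ : ℚ) {a : laurentPuiseux} (ha : a ≠ 0) :
    ∃ c : ℂ, c ≠ 0 ∧ initialForm θ (Polynomial.C a) = Polynomial.C c := by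
  have h0 : (a : HahnSeries ℚ ℂ).coeff (a : HahnSeries ℚ ℂ).order ≠ 0 :=
    fun h => ha (Subtype.ext (HahnSeries.coeff_order_eq_zero.1 h))
  refine ⟨_, h0, ?_⟩
  rw [← coeff_weightedEmb_C θ]
  apply HahnSeries.leadingCoeff_eq_coeff
  · rw [coeff_weightedEmb_C]
    exact Polynomial.C_ne_zero.2 h0
  · intro q hq
    rw [coeff_weightedEmb_C, HahnSeries.coeff_eq_zero_of_lt_order hq, map_zero]

lemma deg_of_ne_zero {a : laurentPuiseux} (ha : a ≠ 0) :
    deg a = ((-(a : HahnSeries ℚ ℂ).order : ℚ) : WithBot ℚ) := if_neg ha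

/-- In `X^θ Y - a` the first term dominates. The zero series falls under this case, its degree being
`⊥`. -/
lemma initialForm_X_sub_C_of_lt {θ : ℚ} {a : laurentPuiseux} (ha : deg a < θ) :
    initialForm θ (Polynomial.X - Polynomial.C a) = Polynomial.X := by
  have hz : ∀ q ≤ -θ, (a : HahnSeries ℚ ℂ).coeff q = 0 := by
    intro q hq
    by_cases h0 : a = 0
    · rw [h0]
      rfl
    · rw [deg_of_ne_zero h0, WithBot.coe_lt_coe] at ha
      exact HahnSeries.coeff_eq_zero_of_lt_order (by linarith)
  have hX : (weightedEmb θ (Polynomial.X - Polynomial.C a)).coeff (-θ) = Polynomial.X := by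
    rw [coeff_weightedEmb_X_sub_C, if_pos rfl, hz _ le_rfl, map_zero, sub_zero]
  rw [initialForm, HahnSeries.leadingCoeff_eq_coeff (g := -θ) (hX ▸ Polynomial.X_ne_zero), hX]
  intro q hq
  rw [coeff_weightedEmb_X_sub_C, if_neg hq.ne, hz _ hq.le, map_zero, sub_zero]

lemma initialForm_X_sub_C_of_eq {θ : ℚ} {a : laurentPuiseux} (ha : deg a = θ) :
    initialForm θ (Polynomial.X - Polynomial.C a) =
      Polynomial.X - Polynomial.C (a : HahnSeries ℚ ℂ).leadingCoeff := by
  have h0 : a ≠ 0 := by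
    rintro rfl
    simp [deg] at ha
  rw [deg_of_ne_zero h0, WithBot.coe_inj] at ha
  have ho : (a : HahnSeries ℚ ℂ).order = -θ := by linarith
  have hX : (weightedEmb θ (Polynomial.X - Polynomial.C a)).coeff (-θ) =
      Polynomial.X - Polynomial.C (a : HahnSeries ℚ ℂ).leadingCoeff := by
    rw [coeff_weightedEmb_X_sub_C, if_pos rfl, HahnSeries.leadingCoeff_eq, ho]
  rw [initialForm, HahnSeries.leadingCoeff_eq_coeff (g := -θ)
    (hX ▸ Polynomial.X_sub_C_ne_zero _), hX]
  intro q hq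
  rw [coeff_weightedEmb_X_sub_C, if_neg hq.ne, HahnSeries.coeff_eq_zero_of_lt_order (ho ▸ hq),
    map_zero, sub_zero]

lemma initialForm_X_sub_C_of_gt {θ : ℚ} {a : laurentPuiseux} (ha : θ < deg a) :
    ∃ c : ℂ, c ≠ 0 ∧ initialForm θ (Polynomial.X - Polynomial.C a) = Polynomial.C c := by
  have h0 : a ≠ 0 := by
    rintro rfl
    simp [deg] at ha
  rw [deg_of_ne_zero h0, WithBot.coe_lt_coe] at ha
  have hc : (a : HahnSeries ℚ ℂ).coeff (a : HahnSeries ℚ ℂ).order ≠ 0 :=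
    fun h => h0 (Subtype.ext (HahnSeries.coeff_order_eq_zero.1 h))
  have hX : (weightedEmb θ (Polynomial.X - Polynomial.C a)).coeff (a : HahnSeries ℚ ℂ).order =
      Polynomial.C (-(a : HahnSeries ℚ ℂ).coeff (a : HahnSeries ℚ ℂ).order) := by
    rw [coeff_weightedEmb_X_sub_C, if_neg (by linarith), zero_sub, map_neg]
  refine ⟨_, neg_ne_zero.2 hc, ?_⟩
  rw [initialForm, HahnSeries.leadingCoeff_eq_coeff (g := (a : HahnSeries ℚ ℂ).order)
    (hX ▸ Polynomial.C_ne_zero.2 (neg_ne_zero.2 hc)), hX]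
  intro q hq
  rw [coeff_weightedEmb_X_sub_C, if_neg (by linarith), HahnSeries.coeff_eq_zero_of_lt_order hq,
    map_zero, sub_zero]

lemma initialForm_X_sub_C_cases (θ : ℚ) (a : laurentPuiseux) :
    (deg a = θ ∧ initialForm θ (Polynomial.X - Polynomial.C a) =
      Polynomial.X - Polynomial.C (a : HahnSeries ℚ ℂ).leadingCoeff) ∨
    (deg a ≠ θ ∧ (initialForm θ (Polynomial.X - Polynomial.C a) = Polynomial.X ∨
      ∃ c : ℂ, c ≠ 0 ∧ initialForm θ (Polynomial.X - Polynomial.C a) = Polynomial.C c)) := by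
  rcases lt_trichotomy (deg a) θ with h | h | h
  · exact Or.inr ⟨h.ne, Or.inl (initialForm_X_sub_C_of_lt h)⟩
  · exact Or.inl ⟨h, initialForm_X_sub_C_of_eq h⟩
  · exact Or.inr ⟨h.ne', Or.inr (initialForm_X_sub_C_of_gt h)⟩

lemma ne_zero_of_deg_eq {a : laurentPuiseux} {θ : ℚ} (h : deg a = θ) : a ≠ 0 := by
  rintro rfl
  simp [deg] at h

/-- The condition `c ≠ 0` matters: the zero monomial does not remember its exponent. -/
lemma leadingTerm_eq_mono_iff {a : laurentPuiseux} {c : ℂ} (hc : c ≠ 0) {θ : ℚ} :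
    leadingTerm a = mono c θ ↔ deg a = θ ∧ (a : HahnSeries ℚ ℂ).leadingCoeff = c := by
  constructor
  · intro h
    have h1 : HahnSeries.single (-(-(a : HahnSeries ℚ ℂ).order)) (a : HahnSeries ℚ ℂ).leadingCoeff =
        HahnSeries.single (-θ) c := congrArg Subtype.val h
    have h2 := congrArg HahnSeries.leadingCoeff h1
    rw [HahnSeries.leadingCoeff_of_single, HahnSeries.leadingCoeff_of_single] at h2
    have h3 := congrArg HahnSeries.order h1
    rw [h2, HahnSeries.order_single hc, HahnSeries.order_single hc, neg_inj] at h3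
    have ha : a ≠ 0 := by
      rintro rfl
      exact hc (h2.symm.trans HahnSeries.leadingCoeff_zero)
    exact ⟨by rw [deg_of_ne_zero ha, h3], h2⟩
  · rintro ⟨h1, h2⟩
    rw [deg_of_ne_zero (ne_zero_of_deg_eq h1), WithBot.coe_inj] at h1
    rw [leadingTerm, h1, h2]

lemma leadingCoeff_ne_zero {a : laurentPuiseux} (ha : a ≠ 0) :
    (a : HahnSeries ℚ ℂ).leadingCoeff ≠ 0 :=
  fun h => ha (Subtype.ext (HahnSeries.leadingCoeff_eq_zero.1 h))

lemma initialForm_X_sub_C_ne_zero (θ : ℚ) (a : laurentPuiseux) :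
    initialForm θ (Polynomial.X - Polynomial.C a) ≠ 0 := by
  rcases initialForm_X_sub_C_cases θ a with ⟨-, h⟩ | ⟨-, h | ⟨c, hc, h⟩⟩
  · exact h ▸ Polynomial.X_sub_C_ne_zero _
  · exact h ▸ Polynomial.X_ne_zero
  · exact h ▸ Polynomial.C_ne_zero.2 hc

lemma initialForm_mul_ne_zero {θ : ℚ} {P Q : Polynomial laurentPuiseux}
    (hP : initialForm θ P ≠ 0) (hQ : initialForm θ Q ≠ 0) : initialForm θ (P * Q) ≠ 0 := by
  rw [initialForm_mul]
  exact mul_ne_zero hP hQ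

open Classical in
lemma rootMultiplicity_initialForm_X_sub_C {c : ℂ} (hc : c ≠ 0) (θ : ℚ) (a : laurentPuiseux) :
    (initialForm θ (Polynomial.X - Polynomial.C a)).rootMultiplicity c =
      if leadingTerm a = mono c θ then 1 else 0 := by
  simp only [leadingTerm_eq_mono_iff hc]
  rcases initialForm_X_sub_C_cases θ a with ⟨hd, h⟩ | ⟨hd, h | ⟨d, hd', h⟩⟩
  · rw [h, Polynomial.rootMultiplicity_X_sub_C]
    simp [hd, eq_comm]
  · rw [h, if_neg (fun h => hd h.1)]
    exact Polynomial.rootMultiplicity_eq_zero (by simpa using hc)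
  · rw [h, if_neg (fun h => hd h.1), Polynomial.rootMultiplicity_C]

open Classical in
-- Degree minus order at `0` counts non-zero roots: `Y` adds to both, a constant to neither, and `Y
-- - a₀` with `a₀ ≠ 0` to the degree alone.
lemma natDegree_initialForm_X_sub_C (θ : ℚ) (a : laurentPuiseux) :
    (initialForm θ (Polynomial.X - Polynomial.C a)).natDegree =
      (initialForm θ (Polynomial.X - Polynomial.C a)).rootMultiplicity 0 +
        if deg a = θ then 1 else 0 := by
  rcases initialForm_X_sub_C_cases θ a with ⟨hd, h⟩ | ⟨hd, h | ⟨d, hd', h⟩⟩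
  · rw [h, if_pos hd, Polynomial.rootMultiplicity_X_sub_C, Polynomial.natDegree_X_sub_C,
      if_neg (leadingCoeff_ne_zero (ne_zero_of_deg_eq hd)).symm]
  · have h2 := Polynomial.rootMultiplicity_X_sub_C_self (x := (0 : ℂ))
    rw [Polynomial.C_0, sub_zero] at h2
    rw [h, if_neg hd, Polynomial.natDegree_X, h2]
  · rw [h, if_neg hd, Polynomial.rootMultiplicity_C, Polynomial.natDegree_C]

open Classical in
-- Degree and root multiplicities are additive over the linear factors; non-vanishing is carried
-- through the induction because that additivity needs it.
lemma initialForm_C_mul_prod {b : laurentPuiseux} (hb : b ≠ 0) (θ : ℚ)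
    (s : Multiset laurentPuiseux) :
    let Φ := initialForm θ (Polynomial.C b *
      (s.map fun a => Polynomial.X - Polynomial.C a).prod)
    Φ ≠ 0 ∧ Φ.natDegree = Φ.rootMultiplicity 0 + s.countP (fun a => deg a = θ) ∧
      ∀ c ≠ 0, Φ.rootMultiplicity c = s.countP fun a => leadingTerm a = mono c θ := by
  induction s using Multiset.induction_on with
  | empty =>
    obtain ⟨d, hd, h⟩ := initialForm_C_ne_zero θ hb
    simp [h, hd]
  | cons a s ih =>
    obtain ⟨h0, h1, h2⟩ := ih
    have hprod : Polynomial.C b * ((a ::ₘ s).map fun a => Polynomial.X - Polynomial.C a).prod =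
        (Polynomial.X - Polynomial.C a) *
          (Polynomial.C b * (s.map fun a => Polynomial.X - Polynomial.C a).prod) := by
      rw [Multiset.map_cons, Multiset.prod_cons]
      ring
    have ha := initialForm_X_sub_C_ne_zero θ a
    have hne := initialForm_mul_ne_zero ha h0
    simp only [hprod]
    refine ⟨hne, ?_, fun c hc => ?_⟩
    · rw [initialForm_mul] at hne ⊢
      rw [Polynomial.natDegree_mul ha h0, Polynomial.rootMultiplicity_mul hne, h1,
        natDegree_initialForm_X_sub_C, Multiset.countP_cons]
      ring
    · rw [initialForm_mul] at hne ⊢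
      rw [Polynomial.rootMultiplicity_mul hne, h2 c hc, rootMultiplicity_initialForm_X_sub_C hc,
        Multiset.countP_cons, add_comm]

open Classical in
/-- The initial form counts the roots of degree `θ` and the roots with a given leading term. -/
theorem initialForm_countP_roots {P : Polynomial laurentPuiseux} (hP : P ≠ 0) (θ : ℚ) :
    (initialForm θ P).natDegree = (initialForm θ P).rootMultiplicity 0 +
        P.roots.countP (fun a => deg a = θ) ∧
      ∀ c ≠ 0, (initialForm θ P).rootMultiplicity c =
        P.roots.countP fun a => leadingTerm a = mono c θ := by
  have h := (initialForm_C_mul_prod (Polynomial.leadingCoeff_ne_zero.2 hP) θ P.roots).2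
  rwa [← (IsAlgClosed.splits P).eq_prod_roots] at h

end LaurentPuiseux

/-! ### Multiplicities of solutions -/

/-- In characteristic zero a root has multiplicity `r` exactly when the derivatives of orders below
`r` vanish there and the one of order `r` does not. A solution has `r > 0`, which matches the
condition `0 < m`. -/
lemma solutionMult_eq_rootMultiplicity {h : ℂ[X][Y]} (hh : toPuiseuxPoly h ≠ 0)
    {a : laurentPuiseux} (ha : IsSolution h a) :
    solutionMult h a = (toPuiseuxPoly h).rootMultiplicity a := by
  have hsub : ∀ m, substitution (Polynomial.derivative^[m] h) a =
      (Polynomial.derivative^[m] (toPuiseuxPoly h)).eval a := by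
    intro m
    rw [substitution, toPuiseuxPoly, toPuiseuxPoly, Polynomial.iterate_derivative_map]
  have hiff : ∀ n, n < (toPuiseuxPoly h).rootMultiplicity a ↔
      ∀ m ≤ n, (Polynomial.derivative^[m] (toPuiseuxPoly h)).eval a = 0 :=
    fun n => Polynomial.lt_rootMultiplicity_iff_isRoot_iterate_derivative hh
  set r := (toPuiseuxPoly h).rootMultiplicity a with hr
  have hpos : 0 < r := (Polynomial.rootMultiplicity_pos hh).2 ha
  refine IsLeast.csInf_eq ⟨⟨hpos, ?_⟩, ?_⟩
  · rw [hsub]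
    intro h0
    refine lt_irrefl r ((hiff r).2 fun m hm => ?_)
    rcases hm.eq_or_lt with rfl | hm
    · exact h0
    · exact (hiff m).1 hm m le_rfl
  · rintro m ⟨-, hm⟩
    rw [hsub] at hm
    by_contra! hlt
    exact hm ((hiff m).1 hlt m le_rfl)

/-- Passes from weighted sums over solutions to counting in the multiset of roots, where the initial
form gives the answer. -/
lemma finite_and_finsum_solutionMult {h : ℂ[X][Y]} (hh : toPuiseuxPoly h ≠ 0)
    (p : laurentPuiseux → Prop) [DecidablePred p] :
    {a | IsSolution h a ∧ p a}.Finite ∧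
      ∑ᶠ a ∈ {a | IsSolution h a ∧ p a}, solutionMult h a = (toPuiseuxPoly h).roots.countP p := by
  classical
  have hset : {a | IsSolution h a ∧ p a} =
      (((toPuiseuxPoly h).roots.filter p).toFinset : Set laurentPuiseux) := by
    ext a
    simp only [Set.mem_ofPred_eq, Finset.mem_coe, Multiset.mem_toFinset, Multiset.mem_filter,
      Polynomial.mem_roots hh]
    rfl
  have hsum : ∑ᶠ a ∈ {a | IsSolution h a ∧ p a}, solutionMult h a =
      ∑ᶠ a ∈ {a | IsSolution h a ∧ p a}, ((toPuiseuxPoly h).roots.filter p).count a := by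
    refine finsum_mem_congr rfl fun a ha => ?_
    rw [solutionMult_eq_rootMultiplicity hh ha.1, Multiset.count_filter_of_pos ha.2,
      Polynomial.count_roots]
  refine ⟨hset ▸ Finset.finite_toSet _, ?_⟩
  rw [hsum, hset, finsum_mem_coe_finset, Multiset.toFinset_sum_count_eq,
    Multiset.countP_eq_card_filter]

/-! ### The initial form of a bivariate polynomial -/

namespace LaurentPuiseux

lemma mono_mul_mono (c d : ℂ) (θ η : ℚ) : mono c θ * mono d η = mono (c * d) (θ + η) := by
  apply Subtype.ext
  change HahnSeries.single (-θ) c * HahnSeries.single (-η) d = HahnSeries.single (-(θ + η)) (c * d)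
  rw [HahnSeries.single_mul_single, neg_add]

lemma mono_pow (c : ℂ) (θ : ℚ) (n : ℕ) : mono c θ ^ n = mono (c ^ n) (n * θ) :=
  Subtype.ext (coe_mono_pow c θ n)

lemma const_eq_mono (c : ℂ) : const c = mono c 0 :=
  Subtype.ext (by
    change HahnSeries.single 0 c = HahnSeries.single (-0) c
    rw [neg_zero])

lemma ofPoly_monomial (n : ℕ) (c : ℂ) : ofPoly (Polynomial.monomial n c) = mono c n := by
  rw [ofPoly, Polynomial.coe_eval₂RingHom, Polynomial.eval₂_monomial, mono_pow, const_eq_mono,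
    mono_mul_mono]
  simp

lemma coeff_coe_mono (c : ℂ) (θ q : ℚ) :
    (mono c θ : HahnSeries ℚ ℂ).coeff q = if q = -θ then c else 0 := by
  refine (HahnSeries.coeff_single (a := -θ) (r := c) (b := q)).trans ?_
  split_ifs <;> rfl

lemma coeff_ofPoly (f : Polynomial ℂ) (n : ℕ) :
    (ofPoly f : HahnSeries ℚ ℂ).coeff (-(n : ℚ)) = f.coeff n := by
  induction f using Polynomial.induction_on' with
  | add p q hp hq =>
    rw [map_add, Polynomial.coeff_add, ← hp, ← hq]
    rfl
  | monomial m c =>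
    rw [ofPoly_monomial, coeff_coe_mono, Polynomial.coeff_monomial]
    simp [eq_comm]

lemma ofPoly_injective : Function.Injective ofPoly := by
  intro f g hfg
  ext n
  rw [← coeff_ofPoly, hfg, coeff_ofPoly]

end LaurentPuiseux

lemma toPuiseuxPoly_ne_zero {h : ℂ[X][Y]} (hh : h ≠ 0) : toPuiseuxPoly h ≠ 0 :=
  (Polynomial.map_ne_zero_iff ofPoly_injective).2 hh

lemma sum_newtonSupport (h : ℂ[X][Y]) :
    ∑ p ∈ newtonSupport h,
      Polynomial.monomial p.2 (Polynomial.monomial p.1 ((h.coeff p.2).coeff p.1)) = h := by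
  ext β α
  simp only [Polynomial.finsetSum_coeff, Polynomial.coeff_monomial]
  rw [Finset.sum_eq_single (α, β)]
  · simp
  · rintro ⟨α', β'⟩ - hne
    split_ifs with h1
    · rw [Polynomial.coeff_monomial, if_neg]
      rintro rfl
      exact hne (by rw [← h1])
    · simp
  · intro hp
    rw [mem_newtonSupport, not_not] at hp
    simp [hp]

lemma toPuiseuxPoly_sum_monomial (h : ℂ[X][Y]) (s : Finset (ℕ × ℕ)) :
    toPuiseuxPoly (∑ p ∈ s,
      Polynomial.monomial p.2 (Polynomial.monomial p.1 ((h.coeff p.2).coeff p.1))) =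
    ∑ p ∈ s, Polynomial.monomial p.2 (mono ((h.coeff p.2).coeff p.1) p.1) := by
  rw [toPuiseuxPoly, Polynomial.map_sum]
  simp only [Polynomial.map_monomial, ofPoly_monomial]

/-- The value at the lattice point `(α, β)` of the weight `α + θ β`. -/
def latticeWeight (θ : ℚ) (p : ℕ × ℕ) : ℚ := p.1 + θ * p.2

/-- A line `α + θβ = N` is never horizontal. Hence distinct monomials of a face stay distinct after
setting `X = 1`. -/
lemma latticeWeight_injOn {θ N : ℚ} {p q : ℕ × ℕ} (hp : latticeWeight θ p = N)
    (hq : latticeWeight θ q = N) (hpq : p.2 = q.2) : p = q := by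
  rw [latticeWeight] at hp hq
  rw [hpq] at hp
  have h : (p.1 : ℚ) = q.1 := by linarith
  exact Prod.ext (by exact_mod_cast h) hpq

/-- The points of the support with weight `α + θ β = N`. -/
def weightFace (h : ℂ[X][Y]) (θ N : ℚ) : Finset (ℕ × ℕ) :=
  (newtonSupport h).filter fun p => latticeWeight θ p = N

lemma mem_weightFace {h : ℂ[X][Y]} {θ N : ℚ} {p : ℕ × ℕ} :
    p ∈ weightFace h θ N ↔ p ∈ newtonSupport h ∧ latticeWeight θ p = N := by
  rw [weightFace, Finset.mem_filter]

/-- The part of `h` of weight `N`, dehomogenized by `X = 1`. -/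
def weightFaceForm (h : ℂ[X][Y]) (θ N : ℚ) : Polynomial ℂ :=
  ∑ p ∈ weightFace h θ N, Polynomial.monomial p.2 ((h.coeff p.2).coeff p.1)

lemma coeff_weightFaceForm {h : ℂ[X][Y]} {θ N : ℚ} {p : ℕ × ℕ} (hp : p ∈ weightFace h θ N) :
    (weightFaceForm h θ N).coeff p.2 = (h.coeff p.2).coeff p.1 := by
  simp only [weightFaceForm, Polynomial.finsetSum_coeff, Polynomial.coeff_monomial]
  rw [Finset.sum_eq_single p]
  · simp
  · intro q hq hqp
    rw [if_neg]
    exact fun h2 => hqp (latticeWeight_injOn (mem_weightFace.1 hq).2 (mem_weightFace.1 hp).2 h2)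
  · exact fun h => absurd hp h

lemma coeff_weightFaceForm_ne_zero {h : ℂ[X][Y]} {θ N : ℚ} {p : ℕ × ℕ}
    (hp : p ∈ weightFace h θ N) : (weightFaceForm h θ N).coeff p.2 ≠ 0 := by
  rw [coeff_weightFaceForm hp]
  exact (mem_newtonSupport h p).1 (mem_weightFace.1 hp).1

lemma coeff_weightFaceForm_eq_zero {h : ℂ[X][Y]} {θ N : ℚ} {n : ℕ}
    (hn : ∀ p ∈ weightFace h θ N, p.2 ≠ n) : (weightFaceForm h θ N).coeff n = 0 := by
  simp only [weightFaceForm, Polynomial.finsetSum_coeff, Polynomial.coeff_monomial]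
  exact Finset.sum_eq_zero fun p hp => if_neg (hn p hp)

lemma natDegree_weightFaceForm {h : ℂ[X][Y]} {θ N : ℚ} {p : ℕ × ℕ}
    (hp : p ∈ weightFace h θ N) (hmax : ∀ q ∈ weightFace h θ N, q.2 ≤ p.2) :
    (weightFaceForm h θ N).natDegree = p.2 := by
  refine le_antisymm (Polynomial.natDegree_le_iff_coeff_eq_zero.2 fun n hn => ?_)
    (Polynomial.le_natDegree_of_ne_zero (coeff_weightFaceForm_ne_zero hp))
  exact coeff_weightFaceForm_eq_zero fun q hq h => by
    have := hmax q hq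
    omega

lemma rootMultiplicity_zero_weightFaceForm {h : ℂ[X][Y]} {θ N : ℚ} {p : ℕ × ℕ}
    (hp : p ∈ weightFace h θ N) (hmin : ∀ q ∈ weightFace h θ N, p.2 ≤ q.2) :
    (weightFaceForm h θ N).rootMultiplicity 0 = p.2 := by
  have hc := coeff_weightFaceForm_ne_zero hp
  have h0 : weightFaceForm h θ N ≠ 0 := fun h => hc (by rw [h, Polynomial.coeff_zero])
  rw [Polynomial.rootMultiplicity_eq_natTrailingDegree']
  refine le_antisymm (Polynomial.natTrailingDegree_le_of_ne_zero hc)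
    (Polynomial.le_natTrailingDegree h0 fun n hn => ?_)
  exact coeff_weightFaceForm_eq_zero fun q hq h => by
    have := hmin q hq
    omega

/-- The form of highest weight of `h` is its initial form. -/
lemma initialForm_toPuiseuxPoly {h : ℂ[X][Y]} {θ N : ℚ}
    (hle : ∀ p ∈ newtonSupport h, latticeWeight θ p ≤ N) (hne : (weightFace h θ N).Nonempty) :
    initialForm θ (toPuiseuxPoly h) = weightFaceForm h θ N := by
  -- Hahn exponents are exponents of `1/X`, so weight `M` sits at `-M` and the maximal weight gives
  -- the leading coefficient.
  have hcoeff : ∀ M, (weightedEmb θ (toPuiseuxPoly h)).coeff (-M) = weightFaceForm h θ M := by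
    intro M
    conv_lhs => rw [← sum_newtonSupport h, toPuiseuxPoly_sum_monomial, map_sum]
    rw [HahnSeries.coeff_sum, weightFaceForm, weightFace, Finset.sum_filter]
    refine Finset.sum_congr rfl fun p _ => ?_
    rw [coeff_weightedEmb_monomial, coeff_coe_mono, apply_ite (Polynomial.monomial p.2), map_zero]
    refine if_congr ?_ rfl rfl
    rw [latticeWeight]
    constructor <;> intro h <;> linarith
  obtain ⟨p, hp⟩ := hne
  rw [initialForm, HahnSeries.leadingCoeff_eq_coeff (g := -N), hcoeff]
  · rw [hcoeff]
    intro h0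
    exact coeff_weightFaceForm_ne_zero hp (by rw [h0, Polynomial.coeff_zero])
  · intro q hq
    rw [← neg_neg q, hcoeff, weightFaceForm]
    refine Finset.sum_eq_zero fun p hp => ?_
    obtain ⟨hps, hpq⟩ := mem_weightFace.1 hp
    have := hle p hps
    linarith

/-- The weighted homogeneous polynomial `∑ h_{αβ} X ^ α Y ^ β`, summed over `α + θ β = N`. -/
lemma toPuiseuxPoly_sum_weightFace (h : ℂ[X][Y]) (θ N : ℚ) :
    toPuiseuxPoly (∑ p ∈ weightFace h θ N,
      Polynomial.monomial p.2 (Polynomial.monomial p.1 ((h.coeff p.2).coeff p.1))) =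
    Polynomial.C (mono 1 N) * ((weightFaceForm h θ N).map const).comp
      (Polynomial.C (mono 1 (-θ)) * Polynomial.X) := by
  rw [toPuiseuxPoly_sum_monomial, weightFaceForm, Polynomial.map_sum, Polynomial.sum_comp,
    Finset.mul_sum]
  refine Finset.sum_congr rfl fun p hp => ?_
  rw [Polynomial.map_monomial, Polynomial.monomial_comp, mul_pow, ← Polynomial.C_pow, ← mul_assoc,
    ← mul_assoc, ← Polynomial.C_mul, ← Polynomial.C_mul, Polynomial.C_mul_X_pow_eq_monomial,
    const_eq_mono, mono_mul_mono, mono_pow, mono_mul_mono]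
  have hN := (mem_weightFace.1 hp).2
  rw [latticeWeight] at hN
  congr 2
  · simp
  · linarith

lemma eval_toPuiseuxPoly_sum_weightFace (h : ℂ[X][Y]) (θ N : ℚ) (c : ℂ) :
    (toPuiseuxPoly (∑ p ∈ weightFace h θ N, Polynomial.monomial p.2
      (Polynomial.monomial p.1 ((h.coeff p.2).coeff p.1)))).eval (mono c θ) =
    mono 1 N * const ((weightFaceForm h θ N).eval c) := by
  rw [toPuiseuxPoly_sum_weightFace, Polynomial.eval_mul, Polynomial.eval_C, Polynomial.eval_comp,
    Polynomial.eval_mul, Polynomial.eval_C, Polynomial.eval_X, mono_mul_mono, one_mul,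
    neg_add_cancel, ← const_eq_mono, Polynomial.eval_map, Polynomial.eval₂_at_apply]

/-- Up to the unit `X^N`, the two polynomials differ by the invertible substitution `Y ↦ X^(-θ) Y`,
which turns the root `c` into `c X^θ`. -/
lemma rootMultiplicity_toPuiseuxPoly_sum_weightFace {h : ℂ[X][Y]} {θ N : ℚ} (c : ℂ)
    (h0 : weightFaceForm h θ N ≠ 0) :
    (toPuiseuxPoly (∑ p ∈ weightFace h θ N, Polynomial.monomial p.2
      (Polynomial.monomial p.1 ((h.coeff p.2).coeff p.1)))).rootMultiplicity (mono c θ) =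
    (weightFaceForm h θ N).rootMultiplicity c := by
  obtain ⟨q, hq, hcq⟩ := Polynomial.exists_eq_pow_rootMultiplicity_mul_and_not_dvd _ h0 c
  set m := (weightFaceForm h θ N).rootMultiplicity c with hm
  set Q := (q.map const).comp (Polynomial.C (mono 1 (-θ)) * Polynomial.X) with hQ
  have hunit : mono 1 N * mono 1 (-θ) ^ m ≠ 0 :=
    mul_ne_zero (mono_ne_zero one_ne_zero _) (pow_ne_zero _ (mono_ne_zero one_ne_zero _))
  have hlin : Polynomial.C (mono 1 (-θ)) * Polynomial.X - Polynomial.C (const c) =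
      Polynomial.C (mono 1 (-θ)) * (Polynomial.X - Polynomial.C (mono c θ)) := by
    rw [mul_sub, ← Polynomial.C_mul, mono_mul_mono, one_mul, neg_add_cancel, const_eq_mono]
  have hQc : Q.eval (mono c θ) ≠ 0 := by
    rw [hQ, Polynomial.eval_comp, Polynomial.eval_mul, Polynomial.eval_C, Polynomial.eval_X,
      mono_mul_mono, one_mul, neg_add_cancel, ← const_eq_mono, Polynomial.eval_map,
      Polynomial.eval₂_at_apply, Ne, map_eq_zero, ← Polynomial.IsRoot.def,
      ← Polynomial.dvd_iff_isRoot]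
    exact hcq
  have hQ0 : Q ≠ 0 := fun h => hQc (by rw [h, Polynomial.eval_zero])
  have heq : Polynomial.C (mono 1 N) * ((weightFaceForm h θ N).map const).comp
      (Polynomial.C (mono 1 (-θ)) * Polynomial.X) =
      (Polynomial.C (mono 1 N * mono 1 (-θ) ^ m) * Q) *
        (Polynomial.X - Polynomial.C (mono c θ)) ^ m := by
    rw [hq, Polynomial.map_mul, Polynomial.map_pow, Polynomial.map_sub, Polynomial.map_X,
      Polynomial.map_C, Polynomial.mul_comp, Polynomial.pow_comp, Polynomial.sub_comp,
      Polynomial.X_comp, Polynomial.C_comp, hlin, mul_pow, Polynomial.C_mul, Polynomial.C_pow]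
    ring
  have hCQ : Polynomial.C (mono 1 N * mono 1 (-θ) ^ m) * Q ≠ 0 :=
    mul_ne_zero (Polynomial.C_ne_zero.2 hunit) hQ0
  rw [toPuiseuxPoly_sum_weightFace, heq, Polynomial.rootMultiplicity_mul_X_sub_C_pow hCQ,
    Polynomial.rootMultiplicity_mul hCQ, Polynomial.rootMultiplicity_C,
    Polynomial.rootMultiplicity_eq_zero hQc, zero_add, zero_add]

/-! ### The right Newton polygon and supporting lines -/

/-- The weight `x + θ y` as a functional on the plane. -/
def planeWeight (θ : ℚ) : StrongDual ℝ (ℝ × ℝ) :=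
  ContinuousLinearMap.fst ℝ ℝ ℝ + (θ : ℝ) • ContinuousLinearMap.snd ℝ ℝ ℝ

lemma planeWeight_apply (θ : ℚ) (x : ℝ × ℝ) : planeWeight θ x = x.1 + θ * x.2 := rfl

lemma planeWeight_latticePoint (θ : ℚ) (p : ℕ × ℕ) :
    planeWeight θ (latticePoint p) = (latticeWeight θ p : ℝ) := by
  rw [planeWeight_apply, latticePoint, latticeWeight]
  push_cast
  rfl

/-- A point on the line through `u` and `v` is determined by its height. -/
lemma eq_add_smul_of_planeWeight_eq {θ : ℚ} {u v x : ℝ × ℝ} (huv : u.2 ≠ v.2)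
    (hv : planeWeight θ v = planeWeight θ u) (hx : planeWeight θ x = planeWeight θ u) :
    x = u + ((x.2 - u.2) / (v.2 - u.2)) • (v - u) := by
  rw [planeWeight_apply, planeWeight_apply] at hv hx
  have hne : v.2 - u.2 ≠ 0 := sub_ne_zero.2 huv.symm
  have h2 : (x.2 - u.2) / (v.2 - u.2) * (v.2 - u.2) = x.2 - u.2 := div_mul_cancel₀ _ hne
  ext
  · simp only [Prod.fst_add, Prod.smul_fst, Prod.fst_sub, smul_eq_mul]
    linear_combination hx - ((x.2 - u.2) / (v.2 - u.2)) * hv + (θ : ℝ) * h2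
  · simp only [Prod.snd_add, Prod.smul_snd, Prod.snd_sub, smul_eq_mul, h2]
    ring

lemma planeWeight_of_mem_segment {θ : ℚ} {u v x : ℝ × ℝ}
    (hv : planeWeight θ v = planeWeight θ u) (hx : x ∈ segment ℝ u v) :
    planeWeight θ x = planeWeight θ u := by
  obtain ⟨a, b, -, -, hab, rfl⟩ := hx
  rw [map_add, map_smul, map_smul, hv, ← add_smul, hab, one_smul]

namespace LatticeSegment

/-- The sign `σ(S)` undoes the absolute values. The signed quotient is what makes the weight `α +
θβ` constant along `S`. -/
lemma declivity_eq (S : LatticeSegment) (h : S.fst.2 ≠ S.snd.2) :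
    S.declivity = -(((S.snd.1 : ℚ) - S.fst.1) / ((S.snd.2 : ℚ) - S.fst.2)) := by
  have hy : (S.snd.2 : ℚ) - S.fst.2 ≠ 0 := sub_ne_zero.2 (by exact_mod_cast h.symm)
  have h1 : (S.len₁ : ℚ) = |(S.snd.1 : ℚ) - S.fst.1| := by
    rw [len₁, Nat.cast_natAbs]
    push_cast
    rfl
  have h2 : (S.len₂ : ℚ) = |(S.snd.2 : ℚ) - S.fst.2| := by
    rw [len₂, Nat.cast_natAbs]
    push_cast
    rfl
  have h3 : S.len₁ = 0 ↔ (S.snd.1 : ℚ) - S.fst.1 = 0 := by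
    rw [← Nat.cast_eq_zero (R := ℚ), h1, abs_eq_zero]
  have h4 : S.len₂ ≠ 0 := by
    rwa [← Nat.cast_ne_zero (R := ℚ), h2, abs_ne_zero]
  rw [declivity, sigma, slope, h1, h2, ← abs_div]
  simp only [h3, h4, or_false]
  generalize (S.snd.1 : ℚ) - S.fst.1 = x
  generalize (S.snd.2 : ℚ) - S.fst.2 = y
  rw [← inv_div x y]
  simp only [inv_pos]
  split_ifs with hx hpos
  · simp [hx]
  · rw [abs_of_pos hpos]
    ring
  · rw [abs_of_nonpos (not_lt.1 hpos)]
    ring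

lemma latticeWeight_snd (S : LatticeSegment) (h : S.fst.2 ≠ S.snd.2) :
    latticeWeight S.declivity S.snd = latticeWeight S.declivity S.fst := by
  have hy : (S.snd.2 : ℚ) - S.fst.2 ≠ 0 := sub_ne_zero.2 (by exact_mod_cast h.symm)
  rw [S.declivity_eq h, latticeWeight, latticeWeight]
  field_simp
  ring

lemma declivity_eq_of_latticeWeight_eq {S : LatticeSegment} (h : S.fst.2 ≠ S.snd.2) {θ : ℚ}
    (hθ : latticeWeight θ S.snd = latticeWeight θ S.fst) : S.declivity = θ := by
  have hy : (S.snd.2 : ℚ) - S.fst.2 ≠ 0 := sub_ne_zero.2 (by exact_mod_cast h.symm)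
  rw [S.declivity_eq h, neg_eq_iff_eq_neg, div_eq_iff hy]
  rw [latticeWeight, latticeWeight] at hθ
  linarith

lemma height_mem_uIcc {S : LatticeSegment} {p : ℕ × ℕ} (hp : latticePoint p ∈ S.toSet) :
    p.2 ∈ Set.uIcc S.fst.2 S.snd.2 := by
  obtain ⟨a, b, ha, hb, hab, h⟩ := hp
  have h2 : a * (S.fst.2 : ℝ) + b * (S.snd.2 : ℝ) = p.2 := congrArg Prod.snd h
  rw [Set.mem_uIcc]
  rcases le_total S.fst.2 S.snd.2 with hle | hle
  · left
    have hle' : (S.fst.2 : ℝ) ≤ S.snd.2 := by exact_mod_cast hle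
    constructor
    · have : (S.fst.2 : ℝ) ≤ p.2 := by nlinarith
      exact_mod_cast this
    · have : (p.2 : ℝ) ≤ S.snd.2 := by nlinarith
      exact_mod_cast this
  · right
    have hle' : (S.snd.2 : ℝ) ≤ S.fst.2 := by exact_mod_cast hle
    constructor
    · have : (S.snd.2 : ℝ) ≤ p.2 := by nlinarith
      exact_mod_cast this
    · have : (p.2 : ℝ) ≤ S.fst.2 := by nlinarith
      exact_mod_cast this

end LatticeSegment

lemma latticePoint_mem_newtonDiagram {h : ℂ[X][Y]} {p : ℕ × ℕ} (hp : p ∈ newtonSupport h) :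
    latticePoint p ∈ newtonDiagram h :=
  subset_convexHull ℝ _ ⟨p, hp, rfl⟩

lemma latticePoint_injective : Function.Injective latticePoint := by
  intro p q h
  rw [latticePoint, latticePoint, Prod.mk.injEq, Nat.cast_inj, Nat.cast_inj] at h
  exact Prod.ext h.1 h.2

/-! ### Segments of the right polygon as faces of maximal weight -/

section RightNewtonPolygon

variable {h : ℂ[X][Y]} {S : LatticeSegment}

lemma toSet_subset_newtonDiagram (hS : S ∈ rightNewtonPolygon h) :
    S.toSet ⊆ newtonDiagram h :=
  IsExposed.subset hS.1

lemma height_ne_of_mem_rightNewtonPolygon (hS : S ∈ rightNewtonPolygon h) :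
    S.fst.2 ≠ S.snd.2 := by
  intro heq
  have hu : latticePoint S.fst ∈ S.toSet := left_mem_segment ℝ _ _
  have hv : latticePoint S.snd ∈ S.toSet := right_mem_segment ℝ _ _
  have heq' : (latticePoint S.fst).2 = (latticePoint S.snd).2 := by simp [latticePoint, heq]
  have h1 := hS.2 _ hu _ (toSet_subset_newtonDiagram hS hv) heq'.symm
  have h2 := hS.2 _ hv _ (toSet_subset_newtonDiagram hS hu) heq'
  exact S.ne (latticePoint_injective (Prod.ext (le_antisymm h2 h1) heq'))

lemma latticePoint_height_ne (hS : S ∈ rightNewtonPolygon h) :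
    (latticePoint S.fst).2 ≠ (latticePoint S.snd).2 := by
  simpa [latticePoint] using height_ne_of_mem_rightNewtonPolygon hS

lemma planeWeight_snd (hS : S ∈ rightNewtonPolygon h) :
    planeWeight S.declivity (latticePoint S.snd) = planeWeight S.declivity (latticePoint S.fst) := by
  rw [planeWeight_latticePoint, planeWeight_latticePoint,
    S.latticeWeight_snd (height_ne_of_mem_rightNewtonPolygon hS)]

/-- If `q` had larger weight, a small move from the midpoint of `S` towards `q` would stay in the
convex diagram and end strictly to the right of the point of `S` at the same height. -/
lemma planeWeight_le_of_mem_newtonDiagram (hS : S ∈ rightNewtonPolygon h) {q : ℝ × ℝ}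
    (hq : q ∈ newtonDiagram h) :
    planeWeight S.declivity q ≤ planeWeight S.declivity (latticePoint S.fst) := by
  by_contra! hlt
  have huv := latticePoint_height_ne hS
  have hw := planeWeight_snd hS
  have hright := hS.2
  have hsub := toSet_subset_newtonDiagram hS
  rw [LatticeSegment.toSet] at hright hsub
  generalize latticePoint S.fst = u at *
  generalize latticePoint S.snd = v at *
  generalize S.declivity = θ at *
  have hne : v.2 - u.2 ≠ 0 := sub_ne_zero.2 huv.symm
  set m : ℝ × ℝ := (1 / 2 : ℝ) • u + (1 / 2 : ℝ) • v with hm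
  -- `D` is the height of `q` above `m` measured in units of `v.2 - u.2`. The choice of `ε` gives
  -- `|ε D| ≤ 1/2`, so the parameter `1/2 + ε D` of the point at the new height stays in `[0, 1]`.
  set D : ℝ := (q.2 - m.2) / (v.2 - u.2) with hD
  set ε : ℝ := 1 / (2 * (1 + |D|)) with hε
  have hDpos : (0 : ℝ) < 1 + |D| := by positivity
  have hεpos : 0 < ε := by positivity
  have hεD : ε * (1 + |D|) = 1 / 2 := by
    rw [hε]
    field_simp
  have hε1 : ε ≤ 1 := by nlinarith [abs_nonneg D]
  have hεD1 : ε * D ≤ 1 / 2 := by nlinarith [le_abs_self D]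
  have hεD2 : -(1 / 2) ≤ ε * D := by nlinarith [neg_abs_le D]
  have hmem : m ∈ segment ℝ u v := ⟨1 / 2, 1 / 2, by norm_num, by norm_num, by norm_num, rfl⟩
  have hx : (1 / 2 - ε * D) • u + (1 / 2 + ε * D) • v ∈ segment ℝ u v :=
    ⟨_, _, by linarith, by linarith, by ring, rfl⟩
  have hy : (1 - ε) • m + ε • q ∈ newtonDiagram h :=
    convex_convexHull ℝ _ (hsub hmem) hq (by linarith) hεpos.le (by ring)
  have hDm : D * (v.2 - u.2) = q.2 - m.2 := div_mul_cancel₀ _ hne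
  have hheight : ((1 - ε) • m + ε • q).2 = ((1 / 2 - ε * D) • u + (1 / 2 + ε * D) • v).2 := by
    have hm2 : m.2 = 1 / 2 * u.2 + 1 / 2 * v.2 := rfl
    simp only [Prod.snd_add, Prod.smul_snd, smul_eq_mul]
    linear_combination (-ε) * hDm + hm2
  have hle := hright _ hx _ hy hheight
  have hwx := planeWeight_of_mem_segment hw hx
  have hwm := planeWeight_of_mem_segment hw hmem
  have hwy : planeWeight θ ((1 - ε) • m + ε • q) =
      (1 - ε) * planeWeight θ m + ε * planeWeight θ q := by
    rw [map_add, map_smul, map_smul, smul_eq_mul, smul_eq_mul]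
  rw [planeWeight_apply _ (_ + _), hheight] at hwy
  rw [planeWeight_apply _ (_ + _)] at hwx
  rw [hwm] at hwy
  nlinarith [mul_pos hεpos (sub_pos.2 hlt)]

/-- A functional exposing `S` takes equal values at its two ends, hence is constant on the whole
line through them; any point of the diagram on that line is therefore also a maximum, so lies in
`S`. -/
lemma mem_toSet_iff_planeWeight_eq (hS : S ∈ rightNewtonPolygon h) {q : ℝ × ℝ}
    (hq : q ∈ newtonDiagram h) :
    q ∈ S.toSet ↔ planeWeight S.declivity q = planeWeight S.declivity (latticePoint S.fst) := by
  refine ⟨planeWeight_of_mem_segment (planeWeight_snd hS), fun hqw => ?_⟩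
  have hu : latticePoint S.fst ∈ S.toSet := left_mem_segment ℝ _ _
  have hv : latticePoint S.snd ∈ S.toSet := right_mem_segment ℝ _ _
  obtain ⟨l, hl⟩ := hS.1 ⟨_, hu⟩
  rw [hl] at hu hv ⊢
  refine ⟨hq, fun y hy => ?_⟩
  have hluv : l (latticePoint S.snd) = l (latticePoint S.fst) :=
    le_antisymm (hu.2 _ hv.1) (hv.2 _ hu.1)
  rw [eq_add_smul_of_planeWeight_eq (latticePoint_height_ne hS) (planeWeight_snd hS) hqw, map_add,
    map_smul, map_sub, hluv, sub_self, smul_zero, add_zero]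
  exact hu.2 y hy

lemma left_mem_extremePoints_segment {E : Type*} [AddCommGroup E] [Module ℝ E] {u v : E}
    (huv : u ≠ v) : u ∈ (segment ℝ u v).extremePoints ℝ := by
  refine ⟨left_mem_segment ℝ u v, ?_⟩
  rintro x hx y hy ⟨a, b, ha, hb, hab, hxy⟩
  rw [segment_eq_image'] at hx hy
  obtain ⟨s, hs, rfl⟩ := hx
  obtain ⟨t, ht, rfl⟩ := hy
  have h1 : (a * s + b * t) • (v - u) = 0 := by
    have h2 : a • (u + s • (v - u)) + b • (u + t • (v - u)) =
        (a + b) • u + (a * s + b * t) • (v - u) := by module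
    rw [h2, hab, one_smul] at hxy
    simpa using hxy
  have h3 : a * s + b * t = 0 := (smul_eq_zero.1 h1).resolve_right (sub_ne_zero.2 huv.symm)
  have h4 : s = 0 := by
    have := mul_nonneg ha.le hs.1
    have := mul_nonneg hb.le ht.1
    have h5 : a * s = 0 := by linarith
    exact (mul_eq_zero.1 h5).resolve_left ha.ne'
  simp [h4]

/-- Extreme points of an exposed face are extreme in the diagram, and extreme points of a convex
hull belong to the generating set. -/
lemma mem_newtonSupport_of_mem_extremePoints (hS : S ∈ rightNewtonPolygon h) {p : ℕ × ℕ}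
    (hp : latticePoint p ∈ S.toSet.extremePoints ℝ) : p ∈ newtonSupport h := by
  obtain ⟨q, hq, hqp⟩ := extremePoints_convexHull_subset
    (hS.1.isExtreme.extremePoints_subset_extremePoints hp)
  rwa [← latticePoint_injective hqp]

lemma fst_mem_newtonSupport (hS : S ∈ rightNewtonPolygon h) : S.fst ∈ newtonSupport h :=
  mem_newtonSupport_of_mem_extremePoints hS
    (left_mem_extremePoints_segment fun e => S.ne (latticePoint_injective e))

lemma snd_mem_newtonSupport (hS : S ∈ rightNewtonPolygon h) : S.snd ∈ newtonSupport h := by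
  refine mem_newtonSupport_of_mem_extremePoints hS ?_
  rw [LatticeSegment.toSet, segment_symm]
  exact left_mem_extremePoints_segment fun e => S.ne (latticePoint_injective e).symm

lemma latticeWeight_le_of_mem_newtonSupport (hS : S ∈ rightNewtonPolygon h) {p : ℕ × ℕ}
    (hp : p ∈ newtonSupport h) :
    latticeWeight S.declivity p ≤ latticeWeight S.declivity S.fst := by
  have := planeWeight_le_of_mem_newtonDiagram hS (latticePoint_mem_newtonDiagram hp)
  rw [planeWeight_latticePoint, planeWeight_latticePoint] at this
  exact_mod_cast this

lemma latticePoint_mem_toSet_iff (hS : S ∈ rightNewtonPolygon h) {p : ℕ × ℕ}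
    (hp : p ∈ newtonSupport h) :
    latticePoint p ∈ S.toSet ↔ latticeWeight S.declivity p = latticeWeight S.declivity S.fst := by
  rw [mem_toSet_iff_planeWeight_eq hS (latticePoint_mem_newtonDiagram hp),
    planeWeight_latticePoint, planeWeight_latticePoint]
  norm_cast

lemma fst_mem_weightFace (hS : S ∈ rightNewtonPolygon h) :
    S.fst ∈ weightFace h S.declivity (latticeWeight S.declivity S.fst) :=
  mem_weightFace.2 ⟨fst_mem_newtonSupport hS, rfl⟩

lemma snd_mem_weightFace (hS : S ∈ rightNewtonPolygon h) :
    S.snd ∈ weightFace h S.declivity (latticeWeight S.declivity S.fst) :=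
  mem_weightFace.2 ⟨snd_mem_newtonSupport hS,
    S.latticeWeight_snd (height_ne_of_mem_rightNewtonPolygon hS)⟩

lemma height_mem_uIcc_of_mem_weightFace (hS : S ∈ rightNewtonPolygon h) {p : ℕ × ℕ}
    (hp : p ∈ weightFace h S.declivity (latticeWeight S.declivity S.fst)) :
    p.2 ∈ Set.uIcc S.fst.2 S.snd.2 := by
  obtain ⟨hp1, hp2⟩ := mem_weightFace.1 hp
  exact LatticeSegment.height_mem_uIcc ((latticePoint_mem_toSet_iff hS hp1).2 hp2)

lemma inForm_eq_sum_weightFace (hS : S ∈ rightNewtonPolygon h) :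
    inForm h S = ∑ p ∈ weightFace h S.declivity (latticeWeight S.declivity S.fst),
      Polynomial.monomial p.2 (Polynomial.monomial p.1 ((h.coeff p.2).coeff p.1)) := by
  classical
  rw [inForm, weightFace]
  refine Finset.sum_congr ?_ fun _ _ => rfl
  ext p
  simp only [Finset.mem_filter]
  exact and_congr_right fun hp => latticePoint_mem_toSet_iff hS hp

/-- The upper end of `S` gives the degree and the lower end the order at `0`; the ends come in no
fixed order, hence two cases. -/
lemma natDegree_weightFaceForm_of_mem (hS : S ∈ rightNewtonPolygon h) :
    (weightFaceForm h S.declivity (latticeWeight S.declivity S.fst)).natDegree =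
      (weightFaceForm h S.declivity (latticeWeight S.declivity S.fst)).rootMultiplicity 0 +
        S.len₂ := by
  have hu := fst_mem_weightFace hS
  have hv := snd_mem_weightFace hS
  have hmem := fun p hp => Set.mem_uIcc.1 (height_mem_uIcc_of_mem_weightFace (p := p) hS hp)
  rw [LatticeSegment.len₂]
  rcases le_total S.fst.2 S.snd.2 with hle | hle
  · rw [natDegree_weightFaceForm hv fun p hp => by have := hmem p hp; omega,
      rootMultiplicity_zero_weightFaceForm hu fun p hp => by have := hmem p hp; omega]
    omega
  · rw [natDegree_weightFaceForm hu fun p hp => by have := hmem p hp; omega,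
      rootMultiplicity_zero_weightFaceForm hv fun p hp => by have := hmem p hp; omega]
    omega

lemma initialForm_declivity (hS : S ∈ rightNewtonPolygon h) :
    initialForm S.declivity (toPuiseuxPoly h) =
      weightFaceForm h S.declivity (latticeWeight S.declivity S.fst) :=
  initialForm_toPuiseuxPoly (fun _ hp => latticeWeight_le_of_mem_newtonSupport hS hp)
    ⟨_, fst_mem_weightFace hS⟩

end RightNewtonPolygon

/-! ### Segments cut out by supporting lines -/

/-- A supporting line of negative reciprocal slope `θ` that meets the support at two levels cuts
out a segment of the right Newton polygon. -/
lemma exists_mem_rightNewtonPolygon {h : ℂ[X][Y]} {θ N : ℚ}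
    (hle : ∀ p ∈ newtonSupport h, latticeWeight θ p ≤ N) {p₁ p₂ : ℕ × ℕ}
    (h₁ : p₁ ∈ weightFace h θ N) (h₂ : p₂ ∈ weightFace h θ N) (hlt : p₁.2 < p₂.2)
    (hmem : ∀ p ∈ weightFace h θ N, p₁.2 ≤ p.2 ∧ p.2 ≤ p₂.2) :
    ∃ S ∈ rightNewtonPolygon h, S.declivity = θ ∧ S.fst = p₁ := by
  obtain ⟨hs₁, hw₁⟩ := mem_weightFace.1 h₁
  obtain ⟨hs₂, hw₂⟩ := mem_weightFace.1 h₂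
  set S : LatticeSegment := ⟨p₁, p₂, fun e => hlt.ne (congrArg Prod.snd e)⟩ with hS
  have hv : planeWeight θ (latticePoint p₁) = N := by rw [planeWeight_latticePoint, hw₁]
  have hv₂ : planeWeight θ (latticePoint p₂) = N := by rw [planeWeight_latticePoint, hw₂]
  have hSw : ∀ x ∈ S.toSet, planeWeight θ x = N := fun x hx =>
    (planeWeight_of_mem_segment (hv₂.trans hv.symm) hx).trans hv
  -- An open half-plane together with a segment of its boundary line is convex. It contains the
  -- support, hence the diagram, which therefore meets the line only in `S`.
  have hconv : Convex ℝ {x | planeWeight θ x < N ∨ x ∈ S.toSet} := by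
    have hC : ∀ x ∈ {x | planeWeight θ x < N ∨ x ∈ S.toSet}, planeWeight θ x ≤ N := by
      rintro x (hx | hx)
      · exact hx.le
      · exact (hSw x hx).le
    intro x hx y hy a b ha hb hab
    rcases ha.eq_or_lt with rfl | ha
    · rw [zero_add] at hab
      simpa [hab] using hy
    rcases hb.eq_or_lt with rfl | hb
    · rw [add_zero] at hab
      simpa [hab] using hx
    by_cases hxy : x ∈ S.toSet ∧ y ∈ S.toSet
    · exact Or.inr (convex_segment _ _ hxy.1 hxy.2 ha.le hb.le hab)
    · left
      rw [map_add, map_smul, map_smul, smul_eq_mul, smul_eq_mul]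
      have hx' := hC x hx
      have hy' := hC y hy
      have hN : (N : ℝ) = a * N + b * N := by rw [← add_mul, hab, one_mul]
      rw [hN]
      rcases hx with hx | hx
      · exact add_lt_add_of_lt_of_le (mul_lt_mul_of_pos_left hx ha)
          (mul_le_mul_of_nonneg_left hy' hb.le)
      · rcases hy with hy | hy
        · exact add_lt_add_of_le_of_lt (mul_le_mul_of_nonneg_left hx' ha.le)
            (mul_lt_mul_of_pos_left hy hb)
        · exact absurd ⟨hx, hy⟩ hxy
  have hsub : newtonDiagram h ⊆ {x | planeWeight θ x < N ∨ x ∈ S.toSet} := by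
    refine convexHull_min ?_ hconv
    rintro _ ⟨p, hp, rfl⟩
    rcases (hle p hp).lt_or_eq with hpN | hpN
    · left
      rw [planeWeight_latticePoint]
      exact_mod_cast hpN
    · right
      obtain ⟨hl, hu⟩ := hmem p (mem_weightFace.2 ⟨hp, hpN⟩)
      have hlt' : ((p₁.2 : ℕ) : ℝ) < p₂.2 := by exact_mod_cast hlt
      have hl' : ((p₁.2 : ℕ) : ℝ) ≤ p.2 := by exact_mod_cast hl
      have hu' : ((p.2 : ℕ) : ℝ) ≤ p₂.2 := by exact_mod_cast hu
      have hpw : planeWeight θ (latticePoint p) = planeWeight θ (latticePoint p₁) := by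
        rw [hv, planeWeight_latticePoint, hpN]
      rw [eq_add_smul_of_planeWeight_eq (u := latticePoint p₁) (v := latticePoint p₂)
        hlt'.ne (hv₂.trans hv.symm) hpw, LatticeSegment.toSet, segment_eq_image']
      refine ⟨_, ⟨?_, ?_⟩, rfl⟩
      · exact div_nonneg (sub_nonneg.2 hl') (sub_nonneg.2 hlt'.le)
      · exact div_le_one_of_le₀ (sub_le_sub_right hu' _) (sub_nonneg.2 hlt'.le)
  have hNle : ∀ x ∈ newtonDiagram h, planeWeight θ x ≤ N := by
    intro x hx
    rcases hsub hx with h | h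
    · exact h.le
    · exact (hSw x h).le
  have hSsub : S.toSet ⊆ newtonDiagram h :=
    (convex_convexHull ℝ _).segment_subset (latticePoint_mem_newtonDiagram hs₁)
      (latticePoint_mem_newtonDiagram hs₂)
  refine ⟨S, ⟨fun _ => ⟨planeWeight θ, ?_⟩, ?_⟩, ?_, rfl⟩
  · ext x
    constructor
    · exact fun hx => ⟨hSsub hx, fun y hy => (hNle y hy).trans (hSw x hx).ge⟩
    · rintro ⟨hx, hmax⟩
      have := hmax _ (latticePoint_mem_newtonDiagram hs₁)
      rw [hv] at this
      exact (hsub hx).resolve_left this.not_gt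
  -- At equal heights, comparing weights is comparing abscissas.
  · intro p hp q hq hqp
    have h1 := hNle q hq
    have h2 := hSw p hp
    rw [planeWeight_apply] at h1 h2
    rw [hqp] at h1
    linarith
  · exact LatticeSegment.declivity_eq_of_latticeWeight_eq hlt.ne (hw₂.trans hw₁.symm)

lemma newtonSupport_nonempty {h : ℂ[X][Y]} (hh : h ≠ 0) : (newtonSupport h).Nonempty := by
  rw [Finset.nonempty_iff_ne_empty]
  intro he
  have := sum_newtonSupport h
  rw [he, Finset.sum_empty] at this
  exact hh this.symm

/-- If the highest form of weight `θ` has a non-zero root, then it belongs to a segment of the right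
Newton polygon. -/
lemma exists_mem_rightNewtonPolygon_of_isRoot {h : ℂ[X][Y]} (hh : h ≠ 0) {θ : ℚ} {c : ℂ}
    (hc : c ≠ 0) (hroot : (initialForm θ (toPuiseuxPoly h)).IsRoot c) :
    ∃ S ∈ rightNewtonPolygon h, S.declivity = θ := by
  obtain ⟨p₀, hp₀, hmax⟩ := Finset.exists_max_image _ (latticeWeight θ) (newtonSupport_nonempty hh)
  have hne : (weightFace h θ (latticeWeight θ p₀)).Nonempty := ⟨p₀, mem_weightFace.2 ⟨hp₀, rfl⟩⟩
  rw [initialForm_toPuiseuxPoly hmax hne] at hroot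
  obtain ⟨p₁, h₁, hmin₁⟩ := Finset.exists_min_image _ Prod.snd hne
  obtain ⟨p₂, h₂, hmax₂⟩ := Finset.exists_max_image _ Prod.snd hne
  rcases (hmin₁ p₂ h₂).lt_or_eq with hlt | heq
  · obtain ⟨S, hS, hSθ, -⟩ := exists_mem_rightNewtonPolygon hmax h₁ h₂ hlt
      fun p hp => ⟨hmin₁ p hp, hmax₂ p hp⟩
    exact ⟨S, hS, hSθ⟩
  -- A face at a single height is one point, and a monomial has no non-zero root.
  · exfalso
    have hsingle : weightFace h θ (latticeWeight θ p₀) = {p₁} := by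
      refine Finset.eq_singleton_iff_unique_mem.2 ⟨h₁, fun p hp => ?_⟩
      exact latticeWeight_injOn (mem_weightFace.1 hp).2 (mem_weightFace.1 h₁).2
        (le_antisymm ((hmax₂ p hp).trans_eq heq.symm) (hmin₁ p hp))
    rw [weightFaceForm, hsingle, Finset.sum_singleton, Polynomial.IsRoot.def,
      Polynomial.eval_monomial] at hroot
    exact mul_ne_zero ((mem_newtonSupport h p₁).1 (mem_weightFace.1 h₁).1) (pow_ne_zero _ hc) hroot

/-! ### Comparison of `inForm` with the initial form, and the theorem -/

lemma isSolution_inForm_mono {h : ℂ[X][Y]} {S : LatticeSegment} (hS : S ∈ rightNewtonPolygon h)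
    {c : ℂ} (hc : (initialForm S.declivity (toPuiseuxPoly h)).IsRoot c) :
    IsSolution (inForm h S) (mono c S.declivity) := by
  rw [initialForm_declivity hS, Polynomial.IsRoot.def] at hc
  rw [IsSolution, substitution, inForm_eq_sum_weightFace hS, eval_toPuiseuxPoly_sum_weightFace, hc,
    map_zero, mul_zero]

/-- `Y - a` divides `h`, so by multiplicativity its initial form `Y - a₀` divides that of `h`. -/
lemma isRoot_initialForm_of_isSolution {h : ℂ[X][Y]} {a : laurentPuiseux} (ha : IsSolution h a)
    {θ : ℚ} (hd : deg a = θ) :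
    (initialForm θ (toPuiseuxPoly h)).IsRoot (a : HahnSeries ℚ ℂ).leadingCoeff := by
  obtain ⟨Q, hQ⟩ := Polynomial.dvd_iff_isRoot.2 (show (toPuiseuxPoly h).IsRoot a from ha)
  rw [hQ, initialForm_mul, initialForm_X_sub_C_of_eq hd]
  simp

lemma rootMultiplicity_inForm {h : ℂ[X][Y]} {S : LatticeSegment} (hS : S ∈ rightNewtonPolygon h)
    (c : ℂ) : (toPuiseuxPoly (inForm h S)).rootMultiplicity (mono c S.declivity) =
      (initialForm S.declivity (toPuiseuxPoly h)).rootMultiplicity c := by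
  rw [initialForm_declivity hS, inForm_eq_sum_weightFace hS]
  refine rootMultiplicity_toPuiseuxPoly_sum_weightFace c fun h0 => ?_
  exact coeff_weightFaceForm_ne_zero (fst_mem_weightFace hS) (by rw [h0, Polynomial.coeff_zero])

lemma Polynomial.rootMultiplicity_eq_of_pow_dvd {R : Type*} [CommRing R] [IsDomain R]
    {p : Polynomial R} {a : R} {k : ℕ} (h1 : (Polynomial.X - Polynomial.C a) ^ k ∣ p)
    (h2 : ¬ (Polynomial.X - Polynomial.C a) ^ (k + 1) ∣ p) : p.rootMultiplicity a = k := by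
  have hp : p ≠ 0 := by
    rintro rfl
    exact h2 (dvd_zero _)
  refine le_antisymm ?_ ((Polynomial.le_rootMultiplicity_iff hp).2 h1)
  exact (Polynomial.rootMultiplicity_le_iff hp a k).2 h2

end

open LaurentPuiseux in
theorem theorem6p3 (h : ℂ[X][Y]) (hh : h ≠ 0) :
    (∀ a : laurentPuiseux, a ≠ 0 → IsSolution h a →
      ∃ S ∈ rightNewtonPolygon h,
        deg a = (S.declivity : WithBot ℚ) ∧ IsSolution (inForm h S) (leadingTerm a)) ∧
    (∀ S ∈ rightNewtonPolygon h,
      ({a : laurentPuiseux | a ≠ 0 ∧ IsSolution h a ∧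
          deg a = (S.declivity : WithBot ℚ)}.Finite ∧
        ∑ᶠ a ∈ {a : laurentPuiseux | a ≠ 0 ∧ IsSolution h a ∧
          deg a = (S.declivity : WithBot ℚ)}, solutionMult h a = S.len₂) ∧
      ∀ (c : ℂ) (k : ℕ), c ≠ 0 →
        (Polynomial.X - Polynomial.C (mono c S.declivity)) ^ k ∣ toPuiseuxPoly (inForm h S) →
        ¬ (Polynomial.X - Polynomial.C (mono c S.declivity)) ^ (k + 1) ∣
            toPuiseuxPoly (inForm h S) →
        {a : laurentPuiseux | IsSolution h a ∧ leadingTerm a = mono c S.declivity}.Finite ∧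
        ∑ᶠ a ∈ {a : laurentPuiseux | IsSolution h a ∧ leadingTerm a = mono c S.declivity},
          solutionMult h a = k) := by
  classical
  have hP : toPuiseuxPoly h ≠ 0 := toPuiseuxPoly_ne_zero hh
  refine ⟨fun a ha hsol => ?_, fun S hS => ⟨?_, fun c k hc hk hk' => ?_⟩⟩
  · have hd := deg_of_ne_zero ha
    have hroot := isRoot_initialForm_of_isSolution hsol hd
    obtain ⟨S, hS, hSθ⟩ :=
      exists_mem_rightNewtonPolygon_of_isRoot hh (leadingCoeff_ne_zero ha) hroot
    rw [← hSθ] at hd hroot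
    refine ⟨S, hS, hd, ?_⟩
    rw [(leadingTerm_eq_mono_iff (leadingCoeff_ne_zero ha)).2 ⟨hd, rfl⟩]
    exact isSolution_inForm_mono hS hroot
  · have hset : {a : laurentPuiseux | a ≠ 0 ∧ IsSolution h a ∧
        deg a = (S.declivity : WithBot ℚ)} =
        {a | IsSolution h a ∧ deg a = (S.declivity : WithBot ℚ)} :=
      Set.ext fun a => ⟨fun h => h.2, fun h => ⟨ne_zero_of_deg_eq h.2, h⟩⟩
    have hcount := (initialForm_countP_roots hP S.declivity).1
    -- Two values of degree minus order at `0`: the polygon gives `|S₂|`, the factorization the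
    -- number of solutions of degree `θ`.
    rw [initialForm_declivity hS, natDegree_weightFaceForm_of_mem hS, add_right_inj] at hcount
    rw [hset, hcount]
    exact finite_and_finsum_solutionMult hP _
  · rw [← Polynomial.rootMultiplicity_eq_of_pow_dvd hk hk', rootMultiplicity_inForm hS,
      (initialForm_countP_roots hP S.declivity).2 c hc]
    exact finite_and_finsum_solutionMult hP _
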